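/- **Existence of the very weak solution, case of a real potential.** Let $\mathbb G$ be a graded Lie group, i.e. a connected simply connected Lie group whose Lie algebra is $\mathfrak g=\bigoplus_{i\ge1}\mathfrak g_i$ with $[\mathfrak g_i,\mathfrak g_j]\subset\mathfrak g_{i+j}$. We identify $\mathbb G$ with $\mathbb R^n$ through global coordinates adapted to the grading (e.g. exponential coordinates): $0$ is the neutral element and, for some positive integers $\nu_1,\dots,\nu_n$, the dilations $D_r(x)=(r^{\nu_1}x_1,\dots,r^{\nu_n}x_n)$, $r>0$, are group automorphisms. Haar measure is then Lebesgue measure; let $Q=\nu_1+\dots+\nu_n$. Let $\mathcal R=\sum_{\nu_1\alpha_1+\dots+\nu_n\alpha_n=\nu}c_\alpha X^\alpha$ be a positive Rockland operator of homogeneous degree $\nu>0$: a left-invariant differential operator with $\langle\mathcal R\varphi,\varphi\rangle_{L^2}\ge0$ for all test functions $\varphi\in\mathcal D(\mathbb G)$ and such that $\pi(\mathcal R)$ is injective on smooth vectors for every nontrivial irreducible unitary representation $\pi$ of $\mathbb G$. Its self-adjoint extension in $L^2(\mathbb G)$, the operator of the closed form $\|\mathcal R^{1/2}f\|_{L^2}^2$,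 is denoted by $\mathcal R$ too, and $H^{\nu/2}(\mathbb G)$ is the completion of $\mathcal D(\mathbb G)$ for the norm $\|\mathcal R^{1/2}f\|_{L^2}+\|f\|_{L^2}$. Let $T>0$, let $V\in L^\infty(\mathbb G)\cup\mathcal E'(\mathbb G)$ be real-valued and let $u_0\in L^2(\mathbb G)\cup\mathcal E'(\mathbb G)$ (complex-valued), where $\mathcal E'(\mathbb G)$ is the space of compactly supported distributions. Then the Cauchy problem $$\partial_tu+\mathcal Ru+Vu=0\ \text{ on }[0,T]\times\mathbb G,\qquad u(0,\cdot)=u_0,$$ has a very weak solution. More precisely, there is an integer $n_0\ge1$ such that the following holds with $\omega(\varepsilon)=(\log\varepsilon^{-n_0})^{-1/n_0}$, $0<\varepsilon<1$. Let $\psi$ be any real-valued smooth compactly supported function on $\mathbb G$ with $\int\psi=1$, let $\psi_\varepsilon(x)=\omega(\varepsilon)^{-Q}\psi(D_{\omega(\varepsilon)^{-1}}x)$, $V_\varepsilon=V*\psi_\varepsilon$ and $u_{0,\varepsilon}=u_0*\psi_\varepsilon$, with group convolution $(f*\psi)(x)=\int f(y)\,\psi(y^{-1}x)\,dy$, understood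 in the sense of distributions. Then: 1. $(V_\varepsilon)$ is $L^\infty$-moderate: for each $\varepsilon_0<1$ there is $C$ with $\|V_\varepsilon\|_{L^\infty}\le C\,\omega(\varepsilon)^{-n_0}=C\log\varepsilon^{-n_0}$ for all $0<\varepsilon\le\varepsilon_0$. 2. $(u_{0,\varepsilon})$ is $H^{\nu/2}$-moderate: there is $N\in\mathbb N$ such that for each $\varepsilon_0<1$ there is $C$ with $\|u_{0,\varepsilon}\|_{H^{\nu/2}}\le C\,\omega(\varepsilon)^{-N}$ for all $0<\varepsilon\le\varepsilon_0$. 3. For each $\varepsilon\in(0,1)$ the regularised problem $\partial_tu_\varepsilon+\mathcal Ru_\varepsilon+V_\varepsilon u_\varepsilon=0$, $u_\varepsilon(0)=u_{0,\varepsilon}$ has a unique solution $u_\varepsilon\in C^1([0,T];L^2(\mathbb G))$ with $u_\varepsilon(t)\in\mathrm{Dom}(\mathcal R)$ for all $t\in[0,T]$. 4. The net $(u_\varepsilon)$ is $C([0,T];L^2(\mathbb G))$-moderate: there is $N\in\mathbb N$ such that for each $\varepsilon_0<1$ there is $C$ with $\sup_{t\in[0,T]}\|u_\varepsilon(t)\|_{L^2}\le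 C\,\varepsilon^{-N}$ for all $0<\varepsilon\le\varepsilon_0$. -/

import Mathlib

open MeasureTheory Set Filter Topology
open scoped Distributions ENNReal ContDiff ComplexConjugate

/-- The space of smooth compactly supported functions on `ℝⁿ` with values in `F`. -/
abbrev TestFn (n : ℕ) (F : Type) [NormedAddCommGroup F] [NormedSpace ℝ F] : Type :=
  𝓓((⊤ : TopologicalSpace.Opens (Fin n → ℝ)), F)

/-- The space `𝓓'` of `F`-valued distributions on `ℝⁿ` (`F = ℝ`: real distributions, `F = ℂ`:
complex ones). -/
abbrev GDistrib (n : ℕ) (F : Type) [NormedAddCommGroup F] [NormedSpace ℝ F] : Type :=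
  𝓓'((⊤ : TopologicalSpace.Opens (Fin n → ℝ)), F)

/-- The complex Hilbert space `L²(ℝⁿ)`. -/
abbrev LTwo (n : ℕ) : Type := Lp ℂ 2 (volume : Measure (Fin n → ℝ))

/-- A graded Lie group of dimension `n`, written in global coordinates adapted to the grading (for
instance exponential coordinates with respect to a basis of the Lie algebra made of bases of the
strata): a Lie group structure on the manifold `ℝⁿ` with neutral element `0`, together with positive
integer weights `ν₁, …, νₙ` such that the dilations `D_r x = (r^ν₁ x₁, …, r^νₙ xₙ)`, `r > 0`, are
automorphisms of the group.

The Lie algebra is graded by `𝔤ᵢ = span {∂ⱼ|₀ : νⱼ = i}`, the eigenspace of the differential of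
`D_r` for the eigenvalue `r ^ i`, and `[𝔤ᵢ, 𝔤ⱼ] ⊆ 𝔤ᵢ₊ⱼ` since this differential is an automorphism
of the Lie algebra. Conversely a connected simply connected Lie group with a graded Lie algebra has
this form, because it is nilpotent, so that its exponential map is a diffeomorphism, and the
canonical dilations of the Lie algebra are automorphisms. -/
structure GradedGroup (n : ℕ) where
  weight : Fin n → ℕ
  weight_pos : ∀ j, 0 < weight j
  mul : (Fin n → ℝ) → (Fin n → ℝ) → (Fin n → ℝ)
  inv : (Fin n → ℝ) → (Fin n → ℝ)
  mul_assoc : ∀ x y z, mul (mul x y) z = mul x (mul y z)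
  zero_mul : ∀ x, mul 0 x = x
  mul_zero : ∀ x, mul x 0 = x
  inv_mul : ∀ x, mul (inv x) x = 0
  mul_inv : ∀ x, mul x (inv x) = 0
  contDiff_mul : ContDiff ℝ ∞ (fun p : (Fin n → ℝ) × (Fin n → ℝ) => mul p.1 p.2)
  contDiff_inv : ContDiff ℝ ∞ inv
  dilation_mul : ∀ r : ℝ, 0 < r → ∀ x y : Fin n → ℝ,
    (fun j => r ^ weight j * mul x y j) =
      mul (fun j => r ^ weight j * x j) (fun j => r ^ weight j * y j)

namespace GradedGroup

variable {n : ℕ} (G : GradedGroup n)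

/-- The dilation `D_r`. -/
def dilation (r : ℝ) (x : Fin n → ℝ) : Fin n → ℝ := fun j => r ^ G.weight j * x j

/-- The homogeneous dimension `Q = ν₁ + ⋯ + νₙ`. -/
def homDim : ℕ := ∑ j, G.weight j

lemma dilation_dilation (r s : ℝ) (x : Fin n → ℝ) :
    G.dilation r (G.dilation s x) = G.dilation (r * s) x := by
  funext j
  simp only [dilation]
  ring

lemma contDiff_dilation (r : ℝ) : ContDiff ℝ ∞ (G.dilation r) := by
  unfold dilation
  fun_prop

/-- `D_r` as a homeomorphism. -/
noncomputable def dilationHomeo (r : ℝ) (hr : 0 < r) : (Fin n → ℝ) ≃ₜ (Fin n → ℝ) where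
  toFun := G.dilation r
  invFun := G.dilation r⁻¹
  left_inv x := by
    rw [dilation_dilation, inv_mul_cancel₀ hr.ne']; funext j; simp [dilation]
  right_inv x := by
    rw [dilation_dilation, mul_inv_cancel₀ hr.ne']; funext j; simp [dilation]
  continuous_toFun := (G.contDiff_dilation r).continuous
  continuous_invFun := (G.contDiff_dilation r⁻¹).continuous

lemma contDiff_inv_mul (x : Fin n → ℝ) : ContDiff ℝ ∞ (fun y => G.mul (G.inv y) x) :=
  G.contDiff_mul.comp (G.contDiff_inv.prodMk contDiff_const)

lemma contDiff_mul_inv (x : Fin n → ℝ) : ContDiff ℝ ∞ (fun y => G.mul x (G.inv y)) :=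
  G.contDiff_mul.comp (contDiff_const.prodMk G.contDiff_inv)

lemma inv_unique {a b : Fin n → ℝ} (h : G.mul a b = 0) : G.inv a = b := by
  have := congrArg (G.mul (G.inv a)) h
  rw [← G.mul_assoc, G.inv_mul, G.zero_mul, G.mul_zero] at this
  exact this.symm

/-- The homeomorphism `y ↦ y⁻¹ x`. -/
noncomputable def invMulHomeo (x : Fin n → ℝ) : (Fin n → ℝ) ≃ₜ (Fin n → ℝ) where
  toFun y := G.mul (G.inv y) x
  invFun y := G.mul x (G.inv y)
  left_inv y := by
    have h : G.inv (G.mul (G.inv y) x) = G.mul (G.inv x) y := by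
      apply G.inv_unique
      rw [G.mul_assoc, ← G.mul_assoc x, G.mul_inv, G.zero_mul, G.inv_mul]
    simp only [h]
    rw [← G.mul_assoc, G.mul_inv, G.zero_mul]
  right_inv y := by
    have h : G.inv (G.mul x (G.inv y)) = G.mul y (G.inv x) := by
      apply G.inv_unique
      rw [G.mul_assoc, ← G.mul_assoc (G.inv y), G.inv_mul, G.zero_mul, G.mul_inv]
    simp only [h]
    rw [G.mul_assoc, G.inv_mul, G.mul_zero]
  continuous_toFun := (G.contDiff_inv_mul x).continuous
  continuous_invFun := (G.contDiff_mul_inv x).continuous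

/-! ### Left-invariant differential operators -/

/-- The left-invariant vector field `Xⱼ` with `Xⱼ|₀ = ∂ⱼ|₀`:
`Xⱼ f (x) = d/dt f (x · t eⱼ)` at `t = 0`. -/
noncomputable def leftField (j : Fin n) (f : (Fin n → ℝ) → ℂ) : (Fin n → ℝ) → ℂ :=
  fun x => deriv (fun t : ℝ => f (G.mul x (Pi.single j t))) 0

/-- `X^α = X₁^α₁ ⋯ Xₙ^αₙ`. -/
noncomputable def leftMonomial (α : Fin n → ℕ) (f : (Fin n → ℝ) → ℂ) : (Fin n → ℝ) → ℂ :=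
  (List.finRange n).foldr (fun j g => (G.leftField j)^[α j] g) f

/-- The left-invariant differential operator `∑ c_α X^α` (a finite sum). -/
noncomputable def diffOp (c : (Fin n → ℕ) →₀ ℂ) (f : (Fin n → ℝ) → ℂ) : (Fin n → ℝ) → ℂ :=
  fun x => c.sum (fun α a => a * G.leftMonomial α f x)

/-- A strongly continuous unitary representation of the group on the Hilbert space `H`. -/
structure UnitaryRep (H : Type) [NormedAddCommGroup H] [InnerProductSpace ℂ H] where
  toFun : (Fin n → ℝ) → (H ≃ₗᵢ[ℂ] H)
  map_mul : ∀ x y v, toFun (G.mul x y) v = toFun x (toFun y v)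
  continuous_apply : ∀ v, Continuous (fun x => toFun x v)

namespace UnitaryRep

variable {G} {H : Type} [NormedAddCommGroup H] [InnerProductSpace ℂ H] (π : G.UnitaryRep H)

/-- `H ≠ 0`, and the only closed invariant subspaces are `0` and `H`. -/
def IsIrreducible : Prop :=
  Nontrivial H ∧ ∀ W : Submodule ℂ H, IsClosed (W : Set H) →
    (∀ x, ∀ v ∈ W, π.toFun x v ∈ W) → W = ⊥ ∨ W = ⊤

/-- Every group element acts as the identity. -/
def IsTrivial : Prop := ∀ x v, π.toFun x v = v

/-- Smooth vectors: those with a smooth orbit map. -/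
def IsSmoothVector (v : H) : Prop := ContDiff ℝ ∞ (fun x => π.toFun x v)

/-- The infinitesimal action `π(Xⱼ) v = d/dt π(t eⱼ) v` at `t = 0` (for smooth vectors `v`). -/
noncomputable def deriv (j : Fin n) (v : H) : H :=
  _root_.deriv (fun t : ℝ => π.toFun (Pi.single j t) v) 0

/-- `π(X)^α = π(X₁)^α₁ ⋯ π(Xₙ)^αₙ`. -/
noncomputable def monomial (α : Fin n → ℕ) (v : H) : H :=
  (List.finRange n).foldr (fun j w => (π.deriv j)^[α j] w) v

/-- `π(R) = ∑ c_α π(X)^α` for `R = ∑ c_α X^α`. -/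
noncomputable def op (c : (Fin n → ℕ) →₀ ℂ) (v : H) : H :=
  c.sum (fun α a => a • π.monomial α v)

end UnitaryRep

/-- A positive Rockland operator `R = ∑ c_α X^α`: a left-invariant differential operator which
is homogeneous of a positive degree `ν` (only `α` with `∑ νⱼ αⱼ = ν` occur), satisfies
`⟨Rφ, φ⟩ ≥ 0` in `L²` for all test functions `φ`, and satisfies the Rockland condition: for each
nontrivial irreducible unitary representation `π`, the operator `π(R)` is injective on the smooth
vectors. -/
structure PositiveRockland where
  coeff : (Fin n → ℕ) →₀ ℂ
  degree : ℕ
  degree_pos : 0 < degree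
  homogeneous : ∀ α ∈ coeff.support, ∑ j, G.weight j * α j = degree
  positive : ∀ φ : TestFn n ℂ,
    0 ≤ (∫ x, G.diffOp coeff φ x * conj (φ x)).re ∧
      (∫ x, G.diffOp coeff φ x * conj (φ x)).im = 0
  rockland : ∀ (H : Type) [NormedAddCommGroup H] [InnerProductSpace ℂ H] [CompleteSpace H]
    (π : G.UnitaryRep H), π.IsIrreducible → ¬ π.IsTrivial →
      ∀ v, π.IsSmoothVector v → π.op coeff v = 0 → v = 0

/-! ### Mollification -/

/-- `ψ_h (x) = h^{-Q} ψ(D_{1/h} x)` for `h > 0` (and the dummy value `0` for `h ≤ 0`). -/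
noncomputable def rescale (ψ : TestFn n ℝ) (h : ℝ) : TestFn n ℝ :=
  if hh : 0 < h then
    { toFun := fun x => (h ^ G.homDim)⁻¹ * ψ (G.dilation h⁻¹ x)
      contDiff' := contDiff_const.mul (ψ.contDiff.comp (G.contDiff_dilation h⁻¹))
      hasCompactSupport' :=
        (ψ.hasCompactSupport.comp_homeomorph (G.dilationHomeo h⁻¹ (inv_pos.mpr hh))).mul_left
      tsupport_subset' := fun _ _ => trivial }
  else 0

/-- The test function `y ↦ ψ(y⁻¹ x)`. -/
noncomputable def reflTranslate (ψ : TestFn n ℝ) (x : Fin n → ℝ) : TestFn n ℝ where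
  toFun y := ψ (G.mul (G.inv y) x)
  contDiff' := ψ.contDiff.comp (G.contDiff_inv_mul x)
  hasCompactSupport' := ψ.hasCompactSupport.comp_homeomorph (G.invMulHomeo x)
  tsupport_subset' := fun _ _ => trivial

/-- Group convolution of a distribution with a test function: `(U * ψ)(x) = ⟨U, ψ(·⁻¹ x)⟩`. When
`U` is a function this is `∫ U(y) ψ(y⁻¹ x) dy`. -/
noncomputable def convolve {F : Type} [NormedAddCommGroup F] [NormedSpace ℝ F]
    (U : GDistrib n F) (ψ : TestFn n ℝ) : (Fin n → ℝ) → F :=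
  fun x => U (G.reflTranslate ψ x)

/-- The regularisation `U_ε = U * ψ_{ω(ε)}`. -/
noncomputable def regularise {F : Type} [NormedAddCommGroup F] [NormedSpace ℝ F]
    (ψ : TestFn n ℝ) (om : ℝ → ℝ) (U : GDistrib n F) (ε : ℝ) : (Fin n → ℝ) → F :=
  G.convolve U (G.rescale ψ (om ε))

end GradedGroup

/-- The distribution `U` is (given by) a function in `L^p`. Lebesgue measure of the coordinate
space is the (bi-invariant) Haar measure of a graded group. -/
def GDistrib.IsInLp {n : ℕ} {F : Type} [NormedAddCommGroup F] [NormedSpace ℝ F]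
    (U : GDistrib n F) (p : ℝ≥0∞) : Prop :=
  ∃ f : (Fin n → ℝ) → F, MemLp f p volume ∧ ∀ φ : TestFn n ℝ, U φ = ∫ x, φ x • f x

/-- `U` is a compactly supported distribution: it vanishes outside some compact set. -/
def GDistrib.IsCompactlySupported {n : ℕ} {F : Type} [NormedAddCommGroup F] [NormedSpace ℝ F]
    (U : GDistrib n F) : Prop :=
  ∃ K : Set (Fin n → ℝ), IsCompact K ∧ Distribution.IsVanishingOn (⇑U) Kᶜ

/-- Friedrichs mollifiers: smooth, compactly supported, of integral one. They are taken
real-valued, so that the regularisation of a real distribution is a real function. -/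
def IsFriedrichsMollifier {n : ℕ} (ψ : TestFn n ℝ) : Prop := ∫ x, ψ x = 1

namespace GradedGroup.PositiveRockland

variable {n : ℕ} {G : GradedGroup n} (R : G.PositiveRockland)

/-- `⟨Rφ, φ⟩ = ‖R^{1/2} φ‖²` in `L²`, the square of the homogeneous Sobolev norm of order
`ν/2` of the test function `φ`. -/
noncomputable def energy (φ : TestFn n ℂ) : ℝ :=
  (∫ x, G.diffOp R.coeff φ x * conj (φ x)).re

/-- The test functions `φ k` converge to `f` in `L²` and form a Cauchy sequence for the
homogeneous Sobolev norm of order `ν/2`. -/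
def Approximates (φ : ℕ → TestFn n ℂ) (f : (Fin n → ℝ) → ℂ) : Prop :=
  Tendsto (fun k => eLpNorm (fun x => φ k x - f x) 2 volume) atTop (𝓝 0) ∧
    ∀ δ > 0, ∃ k₀, ∀ k ≥ k₀, ∀ l ≥ k₀, R.energy (φ k - φ l) < δ

/-- `f` belongs to the Sobolev space `H^{ν/2}`, the completion of the test functions for the norm
`‖R^{1/2} φ‖ + ‖φ‖` in `L²`. -/
def MemSobolev (f : (Fin n → ℝ) → ℂ) : Prop := ∃ φ, R.Approximates φ f

/-- The norm of `H^{ν/2}`: the limit of `‖R^{1/2} φ k‖ + ‖φ k‖` along an approximating sequence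
(the limit exists and does not depend on the sequence), and `∞` if `f` is not in `H^{ν/2}`. -/
noncomputable def sobolevNorm (f : (Fin n → ℝ) → ℂ) : ℝ≥0∞ :=
  ⨅ (φ : ℕ → TestFn n ℂ) (_ : R.Approximates φ f),
    limsup (fun k => ENNReal.ofReal (Real.sqrt (R.energy (φ k))) + eLpNorm (φ k) 2 volume) atTop

/-- `f ∈ Dom(R)` and `R f = g`, for the self-adjoint extension of `R` in `L²`: `f` lies in the form
domain `H^{ν/2}`, and `R f = g` in the sense of distributions, i.e. `⟨f, Rφ⟩ = ⟨g, φ⟩` for all test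
functions `φ` (`R` is formally self-adjoint because it is positive). This is the operator of
the closed quadratic form `‖R^{1/2} f‖²`. -/
def IsValue (f g : LTwo n) : Prop :=
  R.MemSobolev f ∧
    ∀ φ : TestFn n ℂ, ∫ x, f x * conj (G.diffOp R.coeff φ x) = ∫ x, g x * conj (φ x)

/-- `u ∈ C¹([0,T]; L²)` with values in `Dom(R)` solves `∂ₜu + R u + V u = 0` on `[0,T]`,
`u(0) = u₀`. -/
def IsSolution (T : ℝ) (V : (Fin n → ℝ) → ℝ) (u₀ : (Fin n → ℝ) → ℂ) (u : ℝ → LTwo n) : Prop :=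
  (⇑(u 0) =ᵐ[volume] u₀) ∧
    ∃ u' : ℝ → LTwo n, ContinuousOn u' (Icc 0 T) ∧ ∀ t ∈ Icc 0 T,
      HasDerivWithinAt u (u' t) (Icc 0 T) t ∧
        ∃ w : LTwo n, R.IsValue (u t) w ∧
          ∀ᵐ x ∂(volume : Measure (Fin n → ℝ)), u' t x + w x + (V x : ℂ) * u t x = 0

end GradedGroup.PositiveRockland

/-- A net of norms `a ε` is moderate of order `N` with respect to `scale`:
`a ε ≤ C (scale ε)^{-N}` for `0 < ε ≤ ε₀`, with a constant that may depend on `ε₀ < 1`. (The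
logarithmic scale below is not defined at `ε = 1`.) -/
def IsModerateOfOrder (scale : ℝ → ℝ) (a : ℝ → ℝ≥0∞) (N : ℕ) : Prop :=
  ∀ ε₀ ∈ Ioo (0 : ℝ) 1, ∃ C : ℝ, ∀ ε ∈ Ioc 0 ε₀, a ε ≤ ENNReal.ofReal (C * (scale ε ^ N)⁻¹)

/-- Moderateness of a net of norms with respect to `scale`. -/
def IsModerate (scale : ℝ → ℝ) (a : ℝ → ℝ≥0∞) : Prop := ∃ N : ℕ, IsModerateOfOrder scale a N

/-- `ω(ε) = (log ε^{-n₀})^{-1/n₀}`, positive for `0 < ε < 1`, with limit `0` at `0`. -/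
noncomputable def logScale (n₀ : ℕ) (ε : ℝ) : ℝ :=
  (Real.log (ε ^ (-(n₀ : ℝ)))) ^ (-(1 / (n₀ : ℝ)))

/-- The net `(u ε)`, `0 < ε < 1`, is a very weak solution on `[0,T]` of
`∂ₜu + R u + V u = 0`, `u(0) = u₀`, with real `V`, for the regularisations `V_ε = V * ψ_{ω(ε)}` and
`u₀_ε = u₀ * ψ_{ω(ε)}`. -/
structure IsVeryWeakSolution {n : ℕ} {G : GradedGroup n} (R : G.PositiveRockland) (T : ℝ)
    (V : GDistrib n ℝ) (u₀ : GDistrib n ℂ) (ψ : TestFn n ℝ) (om : ℝ → ℝ)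
    (u : ℝ → ℝ → LTwo n) : Prop where
  potential_moderate : IsModerate om (fun ε => eLpNorm (G.regularise ψ om V ε) ⊤ volume)
  datum_moderate : IsModerate om (fun ε => R.sobolevNorm (G.regularise ψ om u₀ ε))
  solution : ∀ ε ∈ Ioo (0 : ℝ) 1,
    R.IsSolution T (G.regularise ψ om V ε) (G.regularise ψ om u₀ ε) (u ε)
  unique : ∀ ε ∈ Ioo (0 : ℝ) 1, ∀ v : ℝ → LTwo n,
    R.IsSolution T (G.regularise ψ om V ε) (G.regularise ψ om u₀ ε) v →
      EqOn v (u ε) (Icc 0 T)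
  /-- The solution net is `C([0,T]; L²)`-moderate, in powers of `ε`. -/
  solution_moderate : IsModerate (fun ε => ε) (fun ε => ⨆ t ∈ Icc 0 T, ‖u ε t‖ₑ)

/-!
The proof regularises the data, solves each regularised problem by a semigroup, and lets the
energy estimate do the rest.

**The self-adjoint extension.** `R` is symmetric and nonnegative on test functions. For a real
`V ∈ L^∞` and `λ > ‖V‖_∞` the form `⟨(R + V + λ) φ, φ⟩` is an inner product on test functions,
stronger than that of `L²`; if `I` is the inclusion of its completion into `L²`, then `J = I I*` is
a bounded, positive, injective operator, the inverse of the Friedrichs extension of `R + V + λ`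
(`exists_resolvent`). With `J` at hand no unbounded operator is needed: `S t = exp (-t J⁻¹)` is
`J` under the continuous functional calculus for `x ↦ exp (-t / x)`, and
`u t = exp (λ t) S t u₀` solves the Cauchy problem as soon as `u₀` lies in the range of `J`
(`exists_isSolution`).

**Energy estimate.** As `⟨R f, f⟩ ≥ 0` on the domain, every solution satisfies
`‖u t‖ ≤ exp (t ‖V‖_∞) ‖u 0‖` (`IsSolution.norm_le`), which contains uniqueness.

**Regularisation.** Left translations, inversion and `y ↦ y⁻¹ x` have Jacobian determinant of
absolute value one: the determinant is compared with its value at `0` by means of the dilations.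
Hence Young's inequalities hold for group convolution, with `‖ψ_h‖₁ = ‖ψ‖₁`, and settle the case of
data in `L^∞` and `L²`. A compactly supported distribution has finite order, so its convolution with
`ψ_h` is a test function of size `O(h^{-N})`. Left-invariant derivatives fall on `ψ_h`, and
`X^α ψ_h = h^{-ν} (X^α ψ)_h` for `α` of homogeneous degree `ν`; so the regularised datum is in the
domain of `R` (`IsRegularisable.exists_isValue`), and its Sobolev norm is `O(h^{-N-ν})`.

**The logarithmic scale.** For `h = ω(ε)` with `n₀` above the order of growth of the potential,
`‖V_ε‖_∞ = O(ω(ε)^{-n₀}) = O(log (1 / ε))`, so that `exp (T ‖V_ε‖_∞)` is bounded by a power of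
`1 / ε`, and moderateness of the solution follows from the energy estimate.
-/

/-! ### The resolvent of a positive symmetric form -/

section Friedrichs

open UniformSpace

variable {D H : Type*} [NormedAddCommGroup H] [InnerProductSpace ℂ H]

/-- If `ι : D → H` is a contraction with dense range of a pre-Hilbert space into a Hilbert space,
extended to `I : D̂ → H` on the completion, then `J = I I*` is the inverse of the operator of the
form `‖·‖²` of `D`. -/
theorem exists_resolvent_of_contraction [CompleteSpace H] [SeminormedAddCommGroup D]
    [InnerProductSpace ℂ D]
    (ι : D →L[ℂ] H) (S : D → H) (hι : ‖ι‖ ≤ 1) (hd : DenseRange ι)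
    (hS : ∀ φ ψ : D, inner ℂ (S φ) (ι ψ) = inner ℂ φ ψ) :
    ∃ J : H →L[ℂ] H, J.IsPositive ∧ ‖J‖ ≤ 1 ∧ Function.Injective J ∧
      ∀ f, (∃ φ : ℕ → D, Tendsto (fun k => ι (φ k)) atTop (𝓝 (J f)) ∧ CauchySeq φ) ∧
        ∀ φ, inner ℂ (S φ) (J f) = inner ℂ (ι φ) f := by
  set I : Completion D →L[ℂ] H := ι.fromCompletion with hI
  have hIc : ∀ φ : D, I φ = ι φ := fun φ => by simp [hI]
  have hIn : ‖I‖ ≤ 1 := by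
    refine ContinuousLinearMap.opNorm_le_bound _ zero_le_one fun k => ?_
    induction k using Completion.induction_on with
    | hp => exact isClosed_le (by fun_prop) (by fun_prop)
    | ih φ => rw [hIc, Completion.norm_coe]; exact ι.le_of_opNorm_le hι φ
  have hker : ∀ f, ContinuousLinearMap.adjoint I f = 0 → f = 0 := by
    intro f hf
    refine hd.eq_zero_of_inner_right ℂ fun φ => ?_
    have : inner ℂ (φ : Completion D) (ContinuousLinearMap.adjoint I f) = 0 := by rw [hf]; simp
    rwa [ContinuousLinearMap.adjoint_inner_right, hIc] at this
  refine ⟨I ∘L ContinuousLinearMap.adjoint I, ContinuousLinearMap.isPositive_self_comp_adjoint I,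
    ?_, ?_, fun f => ⟨?_, fun φ => ?_⟩⟩
  · refine (ContinuousLinearMap.opNorm_comp_le _ _).trans ?_
    rw [LinearIsometryEquiv.norm_map]
    exact mul_le_one₀ hIn (norm_nonneg _) hIn
  · rw [injective_iff_map_eq_zero]
    intro f hf
    apply hker
    have : inner ℂ (I (ContinuousLinearMap.adjoint I f)) f = 0 := by
      have h : I (ContinuousLinearMap.adjoint I f) = 0 := hf
      rw [h]; simp
    rw [← ContinuousLinearMap.adjoint_inner_right, inner_self_eq_zero] at this
    exact this
  · obtain ⟨x, hx, hlim⟩ := mem_closure_iff_seq_limit.mp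
      (Completion.denseRange_coe (α := D) (ContinuousLinearMap.adjoint I f))
    choose φ hφ using hx
    refine ⟨φ, ?_, ?_⟩
    · have := (I.continuous.tendsto _).comp hlim
      refine this.congr fun k => ?_
      simp only [Function.comp_apply, ← hφ, hIc]
    · have h := hlim.cauchySeq
      have hx' : x = fun k => (φ k : Completion D) := funext fun k => (hφ k).symm
      rw [hx'] at h
      rw [Metric.cauchySeq_iff] at h ⊢
      simpa only [Completion.dist_eq] using h
  · have key : ∀ k : Completion D, inner ℂ (S φ) (I k) = inner ℂ (φ : Completion D) k := by
      intro k
      induction k using Completion.induction_on with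
      | hp => exact isClosed_eq (by fun_prop) (by fun_prop)
      | ih ψ => rw [hIc, hS, Completion.inner_coe]
    change inner ℂ (S φ) (I (ContinuousLinearMap.adjoint I f)) = _
    rw [key, ContinuousLinearMap.adjoint_inner_right, hIc]

/-- An operator whose quadratic form is real is symmetric, by polarization. -/
theorem inner_symm_of_im_eq_zero [AddCommGroup D] [Module ℂ D] (ι S : D →ₗ[ℂ] H)
    (h : ∀ φ, (inner ℂ (S φ) (ι φ)).im = 0) (φ ψ : D) :
    inner ℂ (S φ) (ι ψ) = inner ℂ (ι φ) (S ψ) := by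
  have h0 : ∀ φ, inner ℂ (S φ) (ι φ) - inner ℂ (ι φ) (S φ) = 0 := fun φ => by
    rw [← inner_conj_symm (ι φ), sub_eq_zero, eq_comm, Complex.conj_eq_iff_im]
    exact h φ
  have h1 := h0 (φ + ψ)
  have h2 := h0 (φ + Complex.I • ψ)
  have hφ := h0 φ
  have hψ := h0 ψ
  simp only [map_add, map_smul, inner_add_left, inner_add_right, inner_smul_left,
    inner_smul_right, Complex.conj_I] at h1 h2
  set a := inner ℂ (S φ) (ι ψ) - inner ℂ (ι φ) (S ψ) with ha
  set b := inner ℂ (S ψ) (ι φ) - inner ℂ (ι ψ) (S φ) with hb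
  have e1 : a + b = 0 := by rw [ha, hb]; linear_combination h1 - hφ - hψ
  have e2 : Complex.I * (a - b) = 0 := by
    rw [ha, hb]; linear_combination h2 - hφ + Complex.I * Complex.I * hψ
  have e3 : a - b = 0 := (mul_eq_zero.mp e2).resolve_left Complex.I_ne_zero
  have : a = 0 := by linear_combination (e1 + e3) / 2
  exact sub_eq_zero.mp this

/-- The Friedrichs construction: a symmetric operator `S ≥ 1` with dense domain `D` has an extension
with a bounded, positive, injective inverse `J` whose range lies in the completion of `D` for the
form of `S`. -/
theorem exists_friedrichs_resolvent [CompleteSpace H] [AddCommGroup D] [Module ℂ D]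
    (ι S : D →ₗ[ℂ] H)
    (him : ∀ φ, (inner ℂ (S φ) (ι φ)).im = 0)
    (hpos : ∀ φ, ‖ι φ‖ ^ 2 ≤ (inner ℂ (S φ) (ι φ)).re) (hd : DenseRange ι) :
    ∃ J : H →L[ℂ] H, J.IsPositive ∧ ‖J‖ ≤ 1 ∧ Function.Injective J ∧
      ∀ f, (∃ φ : ℕ → D, Tendsto (fun k => ι (φ k)) atTop (𝓝 (J f)) ∧
          ∀ δ > 0, ∃ k₀, ∀ k ≥ k₀, ∀ l ≥ k₀,
            (inner ℂ (S (φ k - φ l)) (ι (φ k - φ l))).re < δ) ∧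
        ∀ φ, inner ℂ (S φ) (J f) = inner ℂ (ι φ) f := by
  let c : PreInnerProductSpace.Core ℂ D :=
    { inner := fun φ ψ => inner ℂ (S φ) (ι ψ)
      conj_inner_symm := fun φ ψ => by
        rw [inner_conj_symm]; exact (inner_symm_of_im_eq_zero ι S him φ ψ).symm
      re_inner_nonneg := fun φ => (sq_nonneg _).trans (hpos φ)
      add_left := fun φ ψ χ => by rw [map_add, inner_add_left]
      smul_left := fun φ ψ r => by rw [map_smul, inner_smul_left] }
  let _ : SeminormedAddCommGroup D :=
    @InnerProductSpace.Core.toSeminormedAddCommGroup ℂ D _ _ _ c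
  let _ : InnerProductSpace ℂ D := InnerProductSpace.ofCore c
  have hnorm : ∀ φ : D, ‖φ‖ ^ 2 = (inner ℂ (S φ) (ι φ)).re := fun φ =>
    norm_sq_eq_re_inner (𝕜 := ℂ) φ
  have hle : ∀ φ : D, ‖ι φ‖ ≤ 1 * ‖φ‖ := fun φ => by
    rw [one_mul]
    exact abs_le_of_sq_le_sq' ((hpos φ).trans_eq (hnorm φ).symm) (norm_nonneg _) |>.2
  obtain ⟨J, h1, h2, h3, h4⟩ := exists_resolvent_of_contraction (ι.mkContinuous 1 hle) S
    (ι.mkContinuous_norm_le zero_le_one hle) hd (fun φ ψ => rfl)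
  refine ⟨J, h1, h2, h3, fun f => ⟨?_, (h4 f).2⟩⟩
  obtain ⟨φ, hφ, hc⟩ := (h4 f).1
  refine ⟨φ, hφ, fun δ hδ => ?_⟩
  obtain ⟨N, hN⟩ := Metric.cauchySeq_iff.mp hc (Real.sqrt δ) (Real.sqrt_pos.mpr hδ)
  refine ⟨N, fun k hk l hl => ?_⟩
  rw [← hnorm, ← Real.lt_sqrt (norm_nonneg _), ← dist_eq_norm]
  exact hN k hk l hl

end Friedrichs

/-! ### The semigroup generated by a bounded inverse -/

section Semigroup

variable {H : Type*} [NormedAddCommGroup H] [InnerProductSpace ℂ H] [CompleteSpace H]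

/-- The semigroup `exp (-t J⁻¹)`, `t ≥ 0`, for a positive contraction `J` with dense range: the
function `s ↦ exp (-t / s)`, extended by `0` to `s ≤ 0`, applied to `J`. For `t ≤ 0` the value is
the identity. -/
noncomputable def invSemigroup (J : H →L[ℂ] H) (t : ℝ) : H →L[ℂ] H :=
  if t ≤ 0 then 1 else cfc (fun s : ℝ => expNegInvGlue (s / t)) J

theorem spectrum_subset_Icc {J : H →L[ℂ] H} (hJ : J.IsPositive) (hJ1 : ‖J‖ ≤ 1) :
    spectrum ℝ J ⊆ Icc 0 1 := by
  intro s hs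
  have h0 : 0 ≤ s := spectrum_nonneg_of_nonneg
    ((ContinuousLinearMap.nonneg_iff_isPositive J).mpr hJ) hs
  refine ⟨h0, ?_⟩
  have := norm_apply_le_norm_cfc (fun x : ℝ => x) J hs (by fun_prop) hJ.isSelfAdjoint
  rw [cfc_id' ℝ J hJ.isSelfAdjoint, Real.norm_of_nonneg h0] at this
  exact this.trans hJ1

theorem expNegInvGlue_div {s t : ℝ} (hs : 0 < s) (ht : 0 < t) :
    expNegInvGlue (s / t) = Real.exp (-(t / s)) := by
  rw [expNegInvGlue, if_neg (not_le.mpr (div_pos hs ht)), inv_div]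

theorem expNegInvGlue_mem (x : ℝ) : 0 ≤ expNegInvGlue x ∧ expNegInvGlue x ≤ 1 := by
  refine ⟨expNegInvGlue.nonneg x, ?_⟩
  unfold expNegInvGlue
  split_ifs with h
  · exact zero_le_one
  · rw [Real.exp_le_one_iff, neg_nonpos]
    exact inv_nonneg.mpr (not_le.mp h).le

theorem norm_invSemigroup_le (J : H →L[ℂ] H) (t : ℝ) : ‖invSemigroup J t‖ ≤ 1 := by
  unfold invSemigroup
  split_ifs
  · exact ContinuousLinearMap.norm_id_le
  · refine norm_cfc_le zero_le_one fun s _ => ?_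
    rw [Real.norm_of_nonneg (expNegInvGlue_mem _).1]
    exact (expNegInvGlue_mem _).2

theorem commute_invSemigroup {J : H →L[ℂ] H} (hJ : J.IsPositive) (t : ℝ) :
    Commute (invSemigroup J t) J := by
  unfold invSemigroup
  split_ifs
  · exact Commute.one_left J
  · have := cfc_commute_cfc (fun s : ℝ => expNegInvGlue (s / t)) (fun x : ℝ => x) J
    rwa [cfc_id' ℝ J hJ.isSelfAdjoint] at this

theorem continuousOn_mul_exp {t : ℝ} (ht : 0 ≤ t) :
    ContinuousOn (fun s : ℝ => s * Real.exp (-(t / s))) (Icc 0 1) := by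
  rcases ht.eq_or_lt with rfl | ht
  · simpa using continuousOn_id' _
  · have : ContinuousOn (fun s : ℝ => s * expNegInvGlue (s / t)) (Icc 0 1) :=
      (continuous_id.mul (expNegInvGlue.contDiff.continuous (n := 0) |>.comp
        (continuous_id.div_const t))).continuousOn
    refine this.congr fun s hs => ?_
    rcases hs.1.eq_or_lt with rfl | h
    · simp
    · simp only [expNegInvGlue_div h ht]

theorem invSemigroup_mul {J : H →L[ℂ] H} (hJ : J.IsPositive) (hJ1 : ‖J‖ ≤ 1) {t : ℝ}
    (ht : 0 ≤ t) : invSemigroup J t * J = cfc (fun s : ℝ => s * Real.exp (-(t / s))) J := by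
  have hsp := spectrum_subset_Icc hJ hJ1
  rcases ht.eq_or_lt with rfl | ht
  · simp only [invSemigroup, le_refl, if_true, one_mul, zero_div, neg_zero, Real.exp_zero, mul_one]
    exact (cfc_id' ℝ J hJ.isSelfAdjoint).symm
  · rw [invSemigroup, if_neg (not_le.mpr ht)]
    nth_rewrite 2 [← cfc_id' ℝ J hJ.isSelfAdjoint]
    rw [← cfc_mul (fun s : ℝ => expNegInvGlue (s / t)) (fun s => s) J
      (expNegInvGlue.contDiff.continuous (n := 0) |>.comp
        (continuous_id.div_const t)).continuousOn continuousOn_id]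
    refine cfc_congr fun s hs => ?_
    rcases (hsp hs).1.eq_or_lt with rfl | h
    · simp
    · simp only [expNegInvGlue_div h ht, mul_comm]

/-- `|e⁻ᵃ - e⁻ᵇ| ≤ |a - b|` for `a, b ≥ 0`. -/
theorem abs_exp_neg_sub_le {a b : ℝ} (ha : 0 ≤ a) (hb : 0 ≤ b) :
    |Real.exp (-a) - Real.exp (-b)| ≤ |a - b| := by
  wlog h : a ≤ b generalizing a b
  · rw [abs_sub_comm, abs_sub_comm a]; exact this hb ha (le_of_not_ge h)
  have h1 : Real.exp (-b) ≤ Real.exp (-a) := Real.exp_le_exp.mpr (by linarith)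
  have h2 : Real.exp (-b) = Real.exp (-a) * Real.exp (a - b) := by
    rw [← Real.exp_add]; congr 1; ring
  have h3 : 1 + (a - b) ≤ Real.exp (a - b) := by linarith [Real.add_one_le_exp (a - b)]
  have h4 : Real.exp (-a) ≤ 1 := Real.exp_le_one_iff.mpr (by linarith)
  rw [abs_of_nonneg (by linarith), abs_of_nonpos (by linarith)]
  nlinarith [Real.exp_pos (-a)]

/-- The first-order Taylor remainder of `e⁻ᵃ` at `b` is at most `(a - b)²` for `a, b ≥ 0`. -/
theorem abs_exp_neg_taylor_le {a b : ℝ} (ha : 0 ≤ a) (hb : 0 ≤ b) :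
    |Real.exp (-a) - Real.exp (-b) + (a - b) * Real.exp (-b)| ≤ (a - b) ^ 2 := by
  have e1 : Real.exp (-a) = Real.exp (-b) * Real.exp (b - a) := by
    rw [← Real.exp_add]; congr 1; ring
  have e2 : Real.exp (-b) = Real.exp (-a) * Real.exp (a - b) := by
    rw [← Real.exp_add]; congr 1; ring
  have h1 := Real.add_one_le_exp (b - a)
  have h2 := Real.add_one_le_exp (a - b)
  have h3 := abs_exp_neg_sub_le hb ha
  have h4 : 0 ≤ Real.exp (-a) - Real.exp (-b) + (a - b) * Real.exp (-b) := by
    nlinarith [Real.exp_pos (-b)]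
  rw [abs_of_nonneg h4]
  have h5 : (a - b) * (Real.exp (-b) - Real.exp (-a)) ≤ (a - b) ^ 2 := by
    refine (le_abs_self _).trans ?_
    rw [abs_mul, ← sq_abs, sq, abs_sub_comm a b] at *
    gcongr
  nlinarith [Real.exp_pos (-a)]

theorem norm_invSemigroup_mul_sub_le {J : H →L[ℂ] H} (hJ : J.IsPositive) (hJ1 : ‖J‖ ≤ 1) {r t : ℝ}
    (hr : 0 ≤ r) (ht : 0 ≤ t) :
    ‖invSemigroup J r * J - invSemigroup J t * J‖ ≤ |r - t| := by
  have hsp := spectrum_subset_Icc hJ hJ1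
  rw [invSemigroup_mul hJ hJ1 hr, invSemigroup_mul hJ hJ1 ht,
    ← cfc_sub _ _ J ((continuousOn_mul_exp hr).mono hsp) ((continuousOn_mul_exp ht).mono hsp)]
  refine norm_cfc_le (abs_nonneg _) fun s hs => ?_
  rcases (hsp hs).1.eq_or_lt with rfl | h
  · simp
  · have := abs_exp_neg_sub_le (div_nonneg hr h.le) (div_nonneg ht h.le)
    rw [← mul_sub, Real.norm_eq_abs, abs_mul, abs_of_pos h]
    refine (mul_le_mul_of_nonneg_left this h.le).trans (le_of_eq ?_)
    rw [← sub_div, abs_div, abs_of_pos h]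
    field_simp

theorem norm_invSemigroup_taylor_le {J : H →L[ℂ] H} (hJ : J.IsPositive) (hJ1 : ‖J‖ ≤ 1) {r t : ℝ}
    (hr : 0 ≤ r) (ht : 0 ≤ t) :
    ‖invSemigroup J r * J * J - invSemigroup J t * J * J + (r - t) • (invSemigroup J t * J)‖
      ≤ (r - t) ^ 2 := by
  have hsp := spectrum_subset_Icc hJ hJ1
  have cr := (continuousOn_mul_exp hr).mono hsp
  have ct := (continuousOn_mul_exp ht).mono hsp
  have hid : cfc (fun s : ℝ => s) J = J := cfc_id' ℝ J hJ.isSelfAdjoint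
  have e : ∀ {q : ℝ}, 0 ≤ q → invSemigroup J q * J * J =
      cfc (fun s : ℝ => s * Real.exp (-(q / s)) * s) J := fun hq => by
    rw [cfc_mul _ (fun s : ℝ => s) J ((continuousOn_mul_exp hq).mono hsp) continuousOn_id, hid,
      invSemigroup_mul hJ hJ1 hq]
  have cr' : ContinuousOn (fun s : ℝ => s * Real.exp (-(r / s)) * s) (spectrum ℝ J) :=
    cr.mul continuousOn_id
  have ct' : ContinuousOn (fun s : ℝ => s * Real.exp (-(t / s)) * s) (spectrum ℝ J) :=
    ct.mul continuousOn_id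
  rw [e hr, e ht, invSemigroup_mul hJ hJ1 ht, ← cfc_sub _ _ J cr' ct',
    ← cfc_smul (r - t) _ J ct, ← cfc_add J _ _ (cr'.fun_sub ct') (ct.fun_const_smul _)]
  refine norm_cfc_le (sq_nonneg _) fun s hs => ?_
  rcases (hsp hs).1.eq_or_lt with rfl | h
  · simpa using sq_nonneg _
  · have := abs_exp_neg_taylor_le (div_nonneg hr h.le) (div_nonneg ht h.le)
    have e : s * Real.exp (-(r / s)) * s - s * Real.exp (-(t / s)) * s +
        (r - t) • (s * Real.exp (-(t / s))) = s ^ 2 * (Real.exp (-(r / s)) - Real.exp (-(t / s)) +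
          (r / s - t / s) * Real.exp (-(t / s))) := by
      rw [smul_eq_mul]; field_simp
    rw [e, Real.norm_eq_abs, abs_mul, abs_of_nonneg (sq_nonneg s)]
    refine (mul_le_mul_of_nonneg_left this (sq_nonneg s)).trans (le_of_eq ?_)
    field_simp

theorem denseRange_of_injective {J : H →L[ℂ] H} (hJ : J.IsPositive) (hinj : Function.Injective J) :
    DenseRange J := by
  have h : (LinearMap.range J.toLinearMap)ᗮ = ⊥ := by
    rw [eq_bot_iff]
    intro v hv
    rw [Submodule.mem_orthogonal] at hv
    have h1 : inner ℂ (J (J v)) v = 0 := hv _ ⟨J v, rfl⟩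
    have h2 : inner ℂ (J (J v)) v = inner ℂ (J v) (J v) := hJ.isSymmetric (J v) v
    rw [h2, inner_self_eq_zero] at h1
    exact (injective_iff_map_eq_zero J).mp hinj v h1
  have := (Submodule.dense_iff_topologicalClosure_eq_top).mpr
    ((Submodule.topologicalClosure_eq_top_iff).mpr h)
  exact this

theorem continuous_invSemigroup_apply {J : H →L[ℂ] H} (hJ : J.IsPositive) (hJ1 : ‖J‖ ≤ 1)
    (hinj : Function.Injective J) (w : H) : Continuous fun t => invSemigroup J t w := by
  have hmax : ∀ t w, invSemigroup J t w = invSemigroup J (max t 0) w := fun t w => by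
    rcases le_total t 0 with h | h
    · rw [max_eq_right h, invSemigroup, invSemigroup, if_pos h, if_pos le_rfl]
    · rw [max_eq_left h]
  have hJz : ∀ z, Continuous fun t => invSemigroup J t (J z) := fun z => by
    have : LipschitzWith ‖z‖₊ fun t => invSemigroup J t (J z) := by
      refine LipschitzWith.of_dist_le_mul fun r t => ?_
      rw [hmax r, hmax t, dist_eq_norm]
      have h1 := norm_invSemigroup_mul_sub_le hJ hJ1 (le_max_right r 0) (le_max_right t 0)
      have h2 := ContinuousLinearMap.le_of_opNorm_le _ h1 z
      refine (le_of_eq_of_le rfl h2).trans ?_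
      rw [mul_comm, Real.dist_eq, coe_nnnorm]
      exact mul_le_mul_of_nonneg_left (abs_max_sub_max_le_abs r t 0) (norm_nonneg z)
    exact this.continuous
  rw [Metric.continuous_iff]
  intro t ε hε
  obtain ⟨z, hz⟩ := (denseRange_of_injective hJ hinj).exists_dist_lt w (ε := ε / 3) (by positivity)
  obtain ⟨δ, hδ, h⟩ := Metric.continuous_iff.mp (hJz z) t (ε / 3) (by positivity)
  refine ⟨δ, hδ, fun r hr => ?_⟩
  have hc : ∀ q, dist (invSemigroup J q w) (invSemigroup J q (J z)) < ε / 3 := fun q => by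
    rw [dist_eq_norm, ← map_sub]
    refine (ContinuousLinearMap.le_of_opNorm_le _ (norm_invSemigroup_le J q) _).trans_lt ?_
    rwa [one_mul, ← dist_eq_norm]
  have h1 := hc r
  have h2 := hc t
  have h3 := h r hr
  rw [dist_comm] at h2
  linarith [dist_triangle4 (invSemigroup J r w) (invSemigroup J r (J z)) (invSemigroup J t (J z))
    (invSemigroup J t w)]

/-- `t ↦ exp (-t J⁻¹) J w` is differentiable on `[0, ∞)` with derivative `- exp (-t J⁻¹) w`. -/
theorem hasDerivWithinAt_invSemigroup {J : H →L[ℂ] H} (hJ : J.IsPositive) (hJ1 : ‖J‖ ≤ 1)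
    (hinj : Function.Injective J) (w : H) {t : ℝ} (ht : 0 ≤ t) :
    HasDerivWithinAt (fun t => invSemigroup J t (J w)) (-(invSemigroup J t w)) (Ici 0) t := by
  have hcont := continuous_invSemigroup_apply hJ hJ1 hinj
  -- on the dense range of `J` the derivative exists in operator norm
  have hder : ∀ z, ∀ t, 0 ≤ t → HasDerivWithinAt (fun t => invSemigroup J t (J (J z)))
      (-(invSemigroup J t (J z))) (Ici 0) t := by
    intro z t ht
    rw [hasDerivWithinAt_iff_isLittleO]
    refine Asymptotics.IsBigO.trans_isLittleO (g := fun r => (r - t) ^ 2) ?_ ?_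
    · refine Asymptotics.IsBigO.of_bound ‖z‖ ?_
      filter_upwards [self_mem_nhdsWithin] with r hr
      have h2 := ContinuousLinearMap.le_of_opNorm_le _ (norm_invSemigroup_taylor_le hJ hJ1 hr ht) z
      rw [mul_comm, Real.norm_of_nonneg (sq_nonneg _)]
      refine le_of_eq_of_le ?_ h2
      congr 1
      simp [sub_eq_add_neg]
    · have : (fun r : ℝ => (r - t) ^ 2) =o[𝓝 t] fun r => r - t :=
        by simpa using Asymptotics.isLittleO_pow_sub_sub t one_lt_two
      exact this.mono nhdsWithin_le_nhds
  -- the integrated form of the identity is stable under limits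
  have hint : ∀ w, ∀ t, 0 ≤ t →
      invSemigroup J t (J w) = J w - ∫ s in (0 : ℝ)..t, invSemigroup J s w := by
    intro w t ht
    refine (denseRange_of_injective hJ hinj).induction_on
      (p := fun w => invSemigroup J t (J w) = J w - ∫ s in (0 : ℝ)..t, invSemigroup J s w) w ?_ ?_
    · refine isClosed_eq (by fun_prop) (J.continuous.sub ?_)
      have : LipschitzWith t.toNNReal fun w => ∫ s in (0 : ℝ)..t, invSemigroup J s w := by
        refine LipschitzWith.of_dist_le_mul fun v w => ?_
        rw [dist_eq_norm, ← intervalIntegral.integral_sub ((hcont v).intervalIntegrable _ _)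
          ((hcont w).intervalIntegrable _ _), dist_eq_norm, Real.coe_toNNReal t ht, mul_comm]
        refine (intervalIntegral.norm_integral_le_of_norm_le_const (C := ‖v - w‖)
          fun s _ => ?_).trans (by rw [sub_zero, abs_of_nonneg ht])
        rw [← map_sub]
        simpa using ContinuousLinearMap.le_of_opNorm_le _ (norm_invSemigroup_le J s) (v - w)
      exact this.continuous
    · intro z
      have h := intervalIntegral.integral_eq_sub_of_hasDeriv_right_of_le ht
        (f := fun t => invSemigroup J t (J (J z))) (f' := fun t => -(invSemigroup J t (J z)))
        (hcont _).continuousOn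
        (fun s hs => (hder z s hs.1.le).mono (Ioi_subset_Ici hs.1.le))
        ((hcont _).neg.intervalIntegrable _ _)
      rw [intervalIntegral.integral_neg] at h
      have h0 : invSemigroup J 0 = 1 := if_pos le_rfl
      simp only [h0, one_apply_eq_self] at h
      rw [sub_eq_add_neg, h, add_sub_cancel]
  have h1 : HasDerivAt (fun t => J w - ∫ s in (0 : ℝ)..t, invSemigroup J s w)
      (-(invSemigroup J t w)) t :=
    (intervalIntegral.integral_hasDerivAt_right ((hcont w).intervalIntegrable _ _)
      ((hcont w).stronglyMeasurableAtFilter _ _) (hcont w).continuousAt).const_sub _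
  exact h1.hasDerivWithinAt.congr (fun r hr => hint w r hr) (hint w t ht)

end Semigroup

/-! ### Haar measure -/

/-- Change of variables for a bijection of `ℝⁿ` with constant Jacobian `c`. -/
theorem lintegral_eq_of_abs_det_fderiv_eq {n : ℕ} {f : (Fin n → ℝ) → (Fin n → ℝ)}
    (hf : Differentiable ℝ f) (hb : Function.Bijective f) {c : ℝ}
    (hc : ∀ x, |(fderiv ℝ f x).det| = c) (g : (Fin n → ℝ) → ℝ≥0∞) :
    ∫⁻ x, g x = ENNReal.ofReal c * ∫⁻ x, g (f x) := by
  have h := lintegral_image_eq_lintegral_abs_det_fderiv_mul volume MeasurableSet.univ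
    (fun x _ => (hf x).hasFDerivAt.hasFDerivWithinAt) hb.injective.injOn g
  rw [image_univ, hb.surjective.range_eq, Measure.restrict_univ] at h
  rw [h, ← lintegral_const_mul' _ _ ENNReal.ofReal_ne_top]
  simp only [hc]

namespace GradedGroup

variable {n : ℕ} (G : GradedGroup n)

theorem dilation_mul_eq {r : ℝ} (hr : 0 < r) (x y : Fin n → ℝ) :
    G.dilation r (G.mul x y) = G.mul (G.dilation r x) (G.dilation r y) :=
  G.dilation_mul r hr x y

theorem dilation_zero_right (r : ℝ) : G.dilation r 0 = 0 := by
  funext j; simp [dilation]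

theorem inv_zero : G.inv 0 = 0 := G.inv_unique (G.mul_zero 0)

theorem inv_inv (x : Fin n → ℝ) : G.inv (G.inv x) = x := G.inv_unique (G.inv_mul x)

theorem inv_mul_cancel (a x : Fin n → ℝ) : G.mul (G.inv a) (G.mul a x) = x := by
  rw [← G.mul_assoc, G.inv_mul, G.zero_mul]

theorem mul_inv_cancel (a x : Fin n → ℝ) : G.mul a (G.mul (G.inv a) x) = x := by
  rw [← G.mul_assoc, G.mul_inv, G.zero_mul]

theorem dilation_inv {r : ℝ} (hr : 0 < r) (x : Fin n → ℝ) :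
    G.dilation r (G.inv x) = G.inv (G.dilation r x) := by
  refine (G.inv_unique ?_).symm
  rw [← G.dilation_mul_eq hr, G.mul_inv, G.dilation_zero_right]

/-- `D_r` as a continuous linear map. -/
noncomputable def dilationCLM (r : ℝ) : (Fin n → ℝ) →L[ℝ] (Fin n → ℝ) :=
  ContinuousLinearMap.pi fun j => r ^ G.weight j • ContinuousLinearMap.proj j

theorem dilationCLM_apply (r : ℝ) (x : Fin n → ℝ) : G.dilationCLM r x = G.dilation r x := rfl

theorem det_dilationCLM (r : ℝ) : (G.dilationCLM r).det = r ^ G.homDim := by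
  have : ((G.dilationCLM r : (Fin n → ℝ) →L[ℝ] (Fin n → ℝ)) : (Fin n → ℝ) →ₗ[ℝ] (Fin n → ℝ)) =
      Matrix.toLin' (Matrix.diagonal fun j => r ^ G.weight j) := by
    ext x j
    simp [dilationCLM_apply, dilation, Matrix.mulVec_diagonal]
  rw [ContinuousLinearMap.det, this, LinearMap.det_toLin', Matrix.det_diagonal,
    Finset.prod_pow_eq_pow_sum, homDim]

theorem tendsto_dilation_zero (x : Fin n → ℝ) :
    Tendsto (fun r => G.dilation r x) (𝓝[>] 0) (𝓝 0) := by
  have : Continuous fun r => G.dilation r x := by unfold dilation; fun_prop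
  have h := (this.tendsto 0).mono_left (nhdsWithin_le_nhds (s := Ioi 0))
  have h0 : G.dilation 0 x = 0 := by
    funext j; simp [dilation, (G.weight_pos j).ne']
  rwa [h0] at h

/-- A smooth family of maps that is equivariant under the dilations has constant Jacobian: the
Jacobian is invariant under the dilations, and these contract everything to `0`. -/
theorem det_fderiv_eq_of_equivariant {Φ : (Fin n → ℝ) → (Fin n → ℝ) → (Fin n → ℝ)}
    (hΦ : ContDiff ℝ ∞ (Function.uncurry Φ))
    (hD : ∀ r : ℝ, 0 < r → ∀ a x, G.dilation r (Φ a x) = Φ (G.dilation r a) (G.dilation r x))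
    (a x : Fin n → ℝ) : (fderiv ℝ (Φ a) x).det = (fderiv ℝ (Φ 0) 0).det := by
  have hdiff : ∀ a, Differentiable ℝ (Φ a) := fun a =>
    (hΦ.comp (contDiff_const.prodMk contDiff_id)).differentiable (by simp)
  have hcont : Continuous fun p : (Fin n → ℝ) × (Fin n → ℝ) => (fderiv ℝ (Φ p.1) p.2).det := by
    refine ContinuousLinearMap.continuous_det.comp ?_
    refine (ContDiff.fderiv (m := ∞) (n := 0) (f := fun p : (Fin n → ℝ) × (Fin n → ℝ) => Φ p.1) ?_
      contDiff_snd (by simp)).continuous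
    exact hΦ.comp ((contDiff_fst.comp contDiff_fst).prodMk contDiff_snd)
  have hinv : ∀ r : ℝ, 0 < r →
      (fderiv ℝ (Φ (G.dilation r a)) (G.dilation r x)).det = (fderiv ℝ (Φ a) x).det := by
    intro r hr
    have h1 : HasFDerivAt (fun x => G.dilation r (Φ a x)) (G.dilationCLM r ∘L fderiv ℝ (Φ a) x) x :=
      (G.dilationCLM r).hasFDerivAt.comp x (hdiff a x).hasFDerivAt
    have h2 : HasFDerivAt (fun x => Φ (G.dilation r a) (G.dilation r x))
        (fderiv ℝ (Φ (G.dilation r a)) (G.dilation r x) ∘L G.dilationCLM r) x :=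
      HasFDerivAt.comp x (g := Φ (G.dilation r a)) (hdiff _ _).hasFDerivAt
        (G.dilationCLM r).hasFDerivAt
    have h3 : (fun x => G.dilation r (Φ a x)) = fun x => Φ (G.dilation r a) (G.dilation r x) :=
      funext fun x => hD r hr a x
    rw [h3] at h1
    have h4 := congrArg ContinuousLinearMap.det (h1.unique h2)
    rw [ContinuousLinearMap.det, ContinuousLinearMap.det, ContinuousLinearMap.toLinearMap_comp,
      ContinuousLinearMap.toLinearMap_comp, LinearMap.det_comp, LinearMap.det_comp, mul_comm] at h4
    have h5 : LinearMap.det (G.dilationCLM r : (Fin n → ℝ) →ₗ[ℝ] (Fin n → ℝ)) ≠ 0 := by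
      have := G.det_dilationCLM r
      rw [ContinuousLinearMap.det] at this
      rw [this]; positivity
    exact (mul_right_cancel₀ h5 h4).symm
  have hlim : Tendsto (fun r : ℝ => (fderiv ℝ (Φ (G.dilation r a)) (G.dilation r x)).det) (𝓝[>] 0)
      (𝓝 (fderiv ℝ (Φ 0) 0).det) :=
    (hcont.tendsto (0, 0)).comp
      ((G.tendsto_dilation_zero a).prodMk_nhds (G.tendsto_dilation_zero x))
  refine tendsto_nhds_unique (Tendsto.congr' ?_ tendsto_const_nhds) hlim
  filter_upwards [self_mem_nhdsWithin] with r hr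
  exact (hinv r hr).symm

/-- Lebesgue measure is invariant under left translations. -/
theorem lintegral_mul_left (a : Fin n → ℝ) (g : (Fin n → ℝ) → ℝ≥0∞) :
    ∫⁻ x, g (G.mul a x) = ∫⁻ x, g x := by
  have hdet : ∀ x, |(fderiv ℝ (G.mul a) x).det| = 1 := fun x => by
    have h := G.det_fderiv_eq_of_equivariant (Φ := G.mul) G.contDiff_mul
      (fun r hr => G.dilation_mul_eq hr) a x
    have h0 : G.mul 0 = id := funext G.zero_mul
    rw [h, h0, fderiv_id, ContinuousLinearMap.det, ContinuousLinearMap.coe_id, LinearMap.det_id,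
      abs_one]
  have hb : Function.Bijective (G.mul a) :=
    ⟨Function.LeftInverse.injective (G.inv_mul_cancel a),
      Function.RightInverse.surjective (G.mul_inv_cancel a)⟩
  have := lintegral_eq_of_abs_det_fderiv_eq
    ((G.contDiff_mul.comp (contDiff_const.prodMk contDiff_id)).differentiable (by simp)) hb hdet g
  simpa using this.symm

/-- Lebesgue measure is invariant under `y ↦ y⁻¹ x`: the group is unimodular. -/
theorem lintegral_inv_mul (x : Fin n → ℝ) (g : (Fin n → ℝ) → ℝ≥0∞) :
    ∫⁻ y, g (G.mul (G.inv y) x) = ∫⁻ y, g y := by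
  have hd : Differentiable ℝ G.inv := G.contDiff_inv.differentiable (by simp)
  have hdet : ∀ y, |(fderiv ℝ (fun y => G.mul (G.inv y) x) y).det| = 1 := fun y => by
    have h := G.det_fderiv_eq_of_equivariant (Φ := fun x y => G.mul (G.inv y) x)
      (G.contDiff_mul.comp ((G.contDiff_inv.comp contDiff_snd).prodMk contDiff_fst))
      (fun r hr a y => by rw [G.dilation_mul_eq hr, G.dilation_inv hr]) x y
    have h0 : (fun y => G.mul (G.inv y) 0) = G.inv := funext fun y => G.mul_zero _
    -- the inversion is an involution fixing `0`, so its Jacobian there squares to one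
    have h1 : HasFDerivAt (G.inv ∘ G.inv) (fderiv ℝ G.inv 0 ∘L fderiv ℝ G.inv 0) 0 := by
      refine HasFDerivAt.comp 0 ?_ (hd 0).hasFDerivAt
      rw [G.inv_zero]; exact (hd 0).hasFDerivAt
    have h2 : G.inv ∘ G.inv = id := funext G.inv_inv
    rw [h2] at h1
    have h3 := congrArg ContinuousLinearMap.det (h1.unique (hasFDerivAt_id 0))
    rw [ContinuousLinearMap.det, ContinuousLinearMap.det, ContinuousLinearMap.toLinearMap_comp,
      LinearMap.det_comp, ContinuousLinearMap.coe_id, LinearMap.det_id, ← sq,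
      ← ContinuousLinearMap.det] at h3
    rw [h, h0]
    rwa [← sq_abs, pow_eq_one_iff_of_nonneg (abs_nonneg _) two_ne_zero] at h3
  have := lintegral_eq_of_abs_det_fderiv_eq
    ((G.contDiff_inv_mul x).differentiable (by simp)) (G.invMulHomeo x).bijective hdet g
  simpa using this.symm

/-- Lebesgue measure is homogeneous of degree `Q` under the dilations. -/
theorem lintegral_dilation {s : ℝ} (hs : 0 < s) (g : (Fin n → ℝ) → ℝ≥0∞) :
    ∫⁻ x, g x = ENNReal.ofReal (s ^ G.homDim) * ∫⁻ x, g (G.dilation s x) := by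
  refine lintegral_eq_of_abs_det_fderiv_eq (f := G.dilation s)
    ((G.contDiff_dilation s).differentiable (by simp)) (G.dilationHomeo s hs).bijective
    (fun x => ?_) g
  have : fderiv ℝ (G.dilation s) x = G.dilationCLM s := (G.dilationCLM s).hasFDerivAt.fderiv
  rw [this, det_dilationCLM, abs_of_pos (by positivity)]

end GradedGroup

/-! ### Left-invariant operators on test functions -/

namespace GradedGroup

variable {n : ℕ} (G : GradedGroup n) {F : Type} [NormedAddCommGroup F] [NormedSpace ℝ F]

/-- The left-invariant vector field `Xⱼ` on functions with values in a normed space; it is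
`leftField` for complex-valued functions. -/
noncomputable def leftDeriv (j : Fin n) (f : (Fin n → ℝ) → F) : (Fin n → ℝ) → F :=
  fun x => deriv (fun t : ℝ => f (G.mul x (Pi.single j t))) 0

/-- The value of the left-invariant vector field `Xⱼ` at `x`. -/
noncomputable def leftVec (j : Fin n) (x : Fin n → ℝ) : Fin n → ℝ :=
  fderiv ℝ (G.mul x) 0 (Pi.single j 1)

theorem contDiff_leftVec (j : Fin n) : ContDiff ℝ ∞ (G.leftVec j) := by
  have : ContDiff ℝ ∞ fun x => fderiv ℝ (G.mul x) 0 :=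
    ContDiff.fderiv (n := ∞) (f := G.mul) G.contDiff_mul contDiff_const (by simp)
  exact this.clm_apply contDiff_const

theorem hasDerivAt_comp_mul_single {f : (Fin n → ℝ) → F} (hf : Differentiable ℝ f) (j : Fin n)
    (x : Fin n → ℝ) : HasDerivAt (fun t : ℝ => f (G.mul x (Pi.single j t)))
      (fderiv ℝ f x (G.leftVec j x)) 0 := by
  have h1 : HasDerivAt (fun t : ℝ => (Pi.single j t : Fin n → ℝ)) (Pi.single j 1) 0 :=
    (ContinuousLinearMap.single ℝ (fun _ : Fin n => ℝ) j).hasDerivAt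
  have h0 : (Pi.single j (0 : ℝ) : Fin n → ℝ) = 0 := Pi.single_zero j
  have h2 : HasFDerivAt (G.mul x) (fderiv ℝ (G.mul x) 0) (Pi.single j (0 : ℝ)) := by
    rw [h0]
    exact ((G.contDiff_mul.comp (contDiff_const.prodMk contDiff_id)).differentiable
      (by simp) 0).hasFDerivAt
  have h3 := h2.comp_hasDerivAt (0 : ℝ) h1
  have h4 : HasFDerivAt f (fderiv ℝ f x) (G.mul x (Pi.single j (0 : ℝ))) := by
    rw [h0, G.mul_zero]; exact (hf x).hasFDerivAt
  exact h4.comp_hasDerivAt (0 : ℝ) h3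

theorem leftDeriv_eq {f : (Fin n → ℝ) → F} (hf : Differentiable ℝ f) (j : Fin n) :
    G.leftDeriv j f = fun x => fderiv ℝ f x (G.leftVec j x) :=
  funext fun x => (G.hasDerivAt_comp_mul_single hf j x).deriv

theorem contDiff_leftDeriv {f : (Fin n → ℝ) → F} (hf : ContDiff ℝ ∞ f) (j : Fin n) :
    ContDiff ℝ ∞ (G.leftDeriv j f) := by
  rw [G.leftDeriv_eq (hf.differentiable (by simp))]
  exact (hf.fderiv_right (by simp)).clm_apply (G.contDiff_leftVec j)

theorem hasCompactSupport_leftDeriv {f : (Fin n → ℝ) → F} (hf : ContDiff ℝ ∞ f)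
    (hc : HasCompactSupport f) (j : Fin n) : HasCompactSupport (G.leftDeriv j f) := by
  rw [G.leftDeriv_eq (hf.differentiable (by simp))]
  refine (hc.fderiv ℝ).mono fun x hx => ?_
  rw [Function.mem_support] at hx ⊢
  contrapose! hx
  rw [hx]; rfl

/-- `Xⱼ` on test functions. -/
noncomputable def leftDerivTest (j : Fin n) (φ : TestFn n F) : TestFn n F where
  toFun := G.leftDeriv j φ
  contDiff' := G.contDiff_leftDeriv φ.contDiff j
  hasCompactSupport' := G.hasCompactSupport_leftDeriv φ.contDiff φ.hasCompactSupport j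
  tsupport_subset' := fun _ _ => trivial

theorem coe_leftDerivTest (j : Fin n) (φ : TestFn n F) :
    ⇑(G.leftDerivTest j φ) = G.leftDeriv j φ := rfl

theorem _root_.TestFn.differentiable (φ : TestFn n F) : Differentiable ℝ φ :=
  φ.contDiff.differentiable (by simp)

theorem leftDerivTest_add (j : Fin n) (φ ψ : TestFn n F) :
    G.leftDerivTest j (φ + ψ) = G.leftDerivTest j φ + G.leftDerivTest j ψ := by
  ext x
  exact ((G.hasDerivAt_comp_mul_single (TestFn.differentiable φ) j x).add
    (G.hasDerivAt_comp_mul_single (TestFn.differentiable ψ) j x)).deriv.trans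
      (congrArg₂ _ (G.hasDerivAt_comp_mul_single (TestFn.differentiable φ) j x).deriv.symm
        (G.hasDerivAt_comp_mul_single (TestFn.differentiable ψ) j x).deriv.symm)

theorem leftDerivTest_smul {A : Type*} [Semiring A] [Module A F] [SMulCommClass ℝ A F]
    [ContinuousConstSMul A F] (j : Fin n) (c : A) (φ : TestFn n F) :
    G.leftDerivTest j (c • φ) = c • G.leftDerivTest j φ := by
  ext x
  exact deriv_fun_const_smul c
    (G.hasDerivAt_comp_mul_single (TestFn.differentiable φ) j x).differentiableAt

/-- `X^α` on test functions. -/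
noncomputable def monomialTest (α : Fin n → ℕ) (φ : TestFn n F) : TestFn n F :=
  (List.finRange n).foldr (fun j g => (G.leftDerivTest j)^[α j] g) φ

theorem coe_iterate_leftDerivTest (j : Fin n) (k : ℕ) (φ : TestFn n ℂ) :
    ⇑((G.leftDerivTest j)^[k] φ) = (G.leftField j)^[k] φ := by
  induction k with
  | zero => rfl
  | succ k ih => rw [Function.iterate_succ_apply', Function.iterate_succ_apply', ← ih]; rfl

theorem coe_monomialTest (α : Fin n → ℕ) (φ : TestFn n ℂ) :
    ⇑(G.monomialTest α φ) = G.leftMonomial α φ := by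
  unfold monomialTest leftMonomial
  induction List.finRange n with
  | nil => rfl
  | cons j l ih => rw [List.foldr_cons, List.foldr_cons, ← ih, coe_iterate_leftDerivTest]

/-- `X^α` is linear on complex test functions. -/
noncomputable def monomialLinear (α : Fin n → ℕ) : TestFn n ℂ →ₗ[ℂ] TestFn n ℂ where
  toFun := G.monomialTest α
  map_add' φ ψ := by
    unfold monomialTest
    have hit : ∀ (j : Fin n) (k : ℕ) (φ ψ : TestFn n ℂ), (G.leftDerivTest j)^[k] (φ + ψ) =
        (G.leftDerivTest j)^[k] φ + (G.leftDerivTest j)^[k] ψ := fun j k φ ψ => by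
      induction k with
      | zero => rfl
      | succ k ih => simp only [Function.iterate_succ_apply', ih, leftDerivTest_add]
    induction List.finRange n with
    | nil => rfl
    | cons j l ih => simp only [List.foldr_cons, ih, hit]
  map_smul' c φ := by
    unfold monomialTest
    have hit : ∀ (j : Fin n) (k : ℕ) (φ : TestFn n ℂ), (G.leftDerivTest j)^[k] (c • φ) =
        c • (G.leftDerivTest j)^[k] φ := fun j k φ => by
      induction k with
      | zero => rfl
      | succ k ih => simp only [Function.iterate_succ_apply', ih, leftDerivTest_smul]
    induction List.finRange n with
    | nil => rfl
    | cons j l ih => simp only [List.foldr_cons, ih, hit, RingHom.id_apply]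

/-- The left-invariant operator `∑ c_α X^α` on test functions. -/
noncomputable def diffOpTest (c : (Fin n → ℕ) →₀ ℂ) : TestFn n ℂ →ₗ[ℂ] TestFn n ℂ :=
  ∑ α ∈ c.support, c α • G.monomialLinear α

theorem diffOpTest_apply (c : (Fin n → ℕ) →₀ ℂ) (φ : TestFn n ℂ) :
    G.diffOpTest c φ = ∑ α ∈ c.support, c α • G.monomialTest α φ := by
  simp only [diffOpTest, LinearMap.sum_apply, LinearMap.smul_apply]
  rfl

theorem _root_.TestFn.sum_apply {ι : Type*} (s : Finset ι) (φ : ι → TestFn n F) (x : Fin n → ℝ) :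
    (∑ i ∈ s, φ i) x = ∑ i ∈ s, φ i x := by
  classical
  induction s using Finset.induction_on with
  | empty => rfl
  | insert i s hi ih => rw [Finset.sum_insert hi, Finset.sum_insert hi, ← ih]; rfl

theorem coe_diffOpTest (c : (Fin n → ℕ) →₀ ℂ) (φ : TestFn n ℂ) :
    ⇑(G.diffOpTest c φ) = G.diffOp c φ := by
  funext x
  rw [diffOpTest_apply, TestFn.sum_apply]
  unfold diffOp
  rw [Finsupp.sum]
  refine Finset.sum_congr rfl fun α _ => ?_
  rw [← coe_monomialTest]; rfl

/-! ### Homogeneity of the left-invariant fields -/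

theorem leftDeriv_comp_dilation {f : (Fin n → ℝ) → F} (j : Fin n) {s : ℝ} (hs : 0 < s)
    (x : Fin n → ℝ) : G.leftDeriv j (fun x => f (G.dilation s x)) x =
      s ^ G.weight j • G.leftDeriv j f (G.dilation s x) := by
  have h : (fun t : ℝ => f (G.dilation s (G.mul x (Pi.single j t)))) =
      fun t : ℝ => (fun t : ℝ => f (G.mul (G.dilation s x) (Pi.single j t)))
        (s ^ G.weight j * t) := by
    funext t
    rw [G.dilation_mul_eq hs]
    congr 2
    funext i
    rcases eq_or_ne i j with rfl | hij
    · simp [dilation]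
    · simp [dilation, Pi.single_eq_of_ne hij]
  unfold leftDeriv
  rw [h]
  refine (deriv_comp_mul_left (s ^ G.weight j)
    (fun t : ℝ => f (G.mul (G.dilation s x) (Pi.single j t))) 0).trans ?_
  rw [MulZeroClass.mul_zero]

theorem coe_rescale (ψ : TestFn n ℝ) {h : ℝ} (hh : 0 < h) (x : Fin n → ℝ) :
    G.rescale ψ h x = (h ^ G.homDim)⁻¹ * ψ (G.dilation h⁻¹ x) := by
  rw [rescale, dif_pos hh]; rfl

theorem leftDerivTest_rescale (j : Fin n) (ψ : TestFn n ℝ) {h : ℝ} (hh : 0 < h) :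
    G.leftDerivTest j (G.rescale ψ h) =
      h⁻¹ ^ G.weight j • G.rescale (G.leftDerivTest j ψ) h := by
  ext x
  have h1 : ⇑(G.rescale ψ h) = fun x => (h ^ G.homDim)⁻¹ • ψ (G.dilation h⁻¹ x) :=
    funext fun x => G.coe_rescale ψ hh x
  have h2 : G.leftDeriv j (fun x => (h ^ G.homDim)⁻¹ • ψ (G.dilation h⁻¹ x)) x =
      (h ^ G.homDim)⁻¹ • G.leftDeriv j (fun x => ψ (G.dilation h⁻¹ x)) x :=
    deriv_fun_const_smul _ (G.hasDerivAt_comp_mul_single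
      ((TestFn.differentiable ψ).comp
        ((G.contDiff_dilation h⁻¹).differentiable (by simp))) j x).differentiableAt
  change G.leftDeriv j (G.rescale ψ h) x = h⁻¹ ^ G.weight j • G.rescale (G.leftDerivTest j ψ) h x
  rw [h1, h2, G.leftDeriv_comp_dilation j (inv_pos.mpr hh), G.coe_rescale _ hh, coe_leftDerivTest]
  simp only [smul_eq_mul]
  ring

/-- `X^α` is homogeneous of degree `∑ νⱼ αⱼ`. -/
theorem monomialTest_rescale (α : Fin n → ℕ) (ψ : TestFn n ℝ) {h : ℝ} (hh : 0 < h) :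
    G.monomialTest α (G.rescale ψ h) =
      h⁻¹ ^ (∑ j, G.weight j * α j) • G.rescale (G.monomialTest α ψ) h := by
  have hit : ∀ (j : Fin n) (k : ℕ) (ψ : TestFn n ℝ) (c : ℝ),
      (G.leftDerivTest j)^[k] (c • G.rescale ψ h) =
        (h⁻¹ ^ (G.weight j * k) * c) • G.rescale ((G.leftDerivTest j)^[k] ψ) h := by
    intro j k ψ c
    induction k with
    | zero => simp
    | succ k ih =>
      rw [Function.iterate_succ_apply', ih, leftDerivTest_smul, leftDerivTest_rescale _ _ _ hh,
        smul_smul, Function.iterate_succ_apply']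
      congr 1
      ring
  have hsum : ∑ j, G.weight j * α j = ((List.finRange n).map fun j => G.weight j * α j).sum := by
    rw [← List.ofFn_eq_map, List.sum_ofFn]
  rw [hsum]
  unfold monomialTest
  induction List.finRange n with
  | nil => simp
  | cons j l ih =>
    rw [List.foldr_cons, List.foldr_cons, ih, hit, List.map_cons, List.sum_cons, pow_add]

end GradedGroup

/-! ### Test functions in `L²` -/

theorem TestFn.memLp {n : ℕ} (φ : TestFn n ℂ) (p : ℝ≥0∞) : MemLp φ p volume :=
  φ.continuous.memLp_of_hasCompactSupport φ.hasCompactSupport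

/-- The embedding of the test functions into `L²`. -/
noncomputable def testToLTwo (n : ℕ) : TestFn n ℂ →ₗ[ℂ] LTwo n where
  toFun φ := (TestFn.memLp φ 2).toLp φ
  map_add' _ _ := MemLp.toLp_add _ _
  map_smul' c _ := MemLp.toLp_const_smul c _

section Embedding

variable {n : ℕ}

theorem coeFn_testToLTwo (φ : TestFn n ℂ) : ⇑(testToLTwo n φ) =ᵐ[volume] φ :=
  MemLp.coeFn_toLp (TestFn.memLp φ 2)

theorem inner_testToLTwo (φ : TestFn n ℂ) (f : LTwo n) :
    inner ℂ (testToLTwo n φ) f = ∫ x, f x * conj (φ x) := by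
  rw [L2.inner_def]
  refine integral_congr_ae ?_
  filter_upwards [coeFn_testToLTwo φ] with x hx
  rw [hx, RCLike.inner_apply]

theorem denseRange_testToLTwo (n : ℕ) : DenseRange (testToLTwo n) := by
  refine (Lp.dense_hasCompactSupport_contDiff (F := ℂ) (p := 2)
    (μ := (volume : Measure (Fin n → ℝ))) (by simp)).mono ?_
  rintro f ⟨g, hfg, hgc, hgs⟩
  refine ⟨⟨g, hgs, hgc, fun _ _ => trivial⟩, ?_⟩
  refine Lp.ext ((coeFn_testToLTwo _).trans hfg.symm)

namespace GradedGroup.PositiveRockland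

variable {G : GradedGroup n} (R : G.PositiveRockland)

/-- `R` as an operator from the test functions to `L²`. -/
noncomputable def testOp : TestFn n ℂ →ₗ[ℂ] LTwo n :=
  testToLTwo n ∘ₗ G.diffOpTest R.coeff

theorem testOp_apply (φ : TestFn n ℂ) : R.testOp φ = testToLTwo n (G.diffOpTest R.coeff φ) := rfl

theorem coeFn_testOp (φ : TestFn n ℂ) : ⇑(R.testOp φ) =ᵐ[volume] G.diffOp R.coeff φ := by
  rw [← coe_diffOpTest]; exact coeFn_testToLTwo _

theorem inner_testToLTwo_testOp (φ : TestFn n ℂ) :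
    inner ℂ (testToLTwo n φ) (R.testOp φ) = ∫ x, G.diffOp R.coeff φ x * conj (φ x) := by
  rw [inner_testToLTwo]
  refine integral_congr_ae ?_
  filter_upwards [R.coeFn_testOp φ] with x hx
  rw [hx]

theorem energy_eq (φ : TestFn n ℂ) :
    R.energy φ = (inner ℂ (R.testOp φ) (testToLTwo n φ)).re := by
  rw [← inner_conj_symm, Complex.conj_re, inner_testToLTwo_testOp]; rfl

theorem energy_nonneg (φ : TestFn n ℂ) : 0 ≤ R.energy φ := (R.positive φ).1

theorem im_inner_testOp (φ : TestFn n ℂ) :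
    (inner ℂ (R.testOp φ) (testToLTwo n φ)).im = 0 := by
  rw [← inner_conj_symm, Complex.conj_im, inner_testToLTwo_testOp, (R.positive φ).2, neg_zero]

theorem inner_testOp_symm (φ ψ : TestFn n ℂ) :
    inner ℂ (R.testOp φ) (testToLTwo n ψ) = inner ℂ (testToLTwo n φ) (R.testOp ψ) :=
  inner_symm_of_im_eq_zero _ _ R.im_inner_testOp φ ψ

theorem energy_le (φ : TestFn n ℂ) : R.energy φ ≤ ‖R.testOp φ‖ * ‖testToLTwo n φ‖ := by
  rw [energy_eq]
  exact (Complex.re_le_norm _).trans (norm_inner_le_norm _ _)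

theorem tendsto_eLpNorm_iff (φ : ℕ → TestFn n ℂ) {f : (Fin n → ℝ) → ℂ} {g : LTwo n}
    (hfg : ⇑g =ᵐ[volume] f) :
    Tendsto (fun k => eLpNorm (fun x => φ k x - f x) 2 volume) atTop (𝓝 0) ↔
      Tendsto (fun k => testToLTwo n (φ k)) atTop (𝓝 g) := by
  rw [tendsto_iff_edist_tendsto_0]
  refine iff_of_eq ?_
  congr 1
  funext k
  rw [Lp.edist_def]
  refine eLpNorm_congr_ae ?_
  filter_upwards [coeFn_testToLTwo (φ k), hfg] with x h1 h2
  rw [Pi.sub_apply, h1, h2]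

theorem approximates_iff (φ : ℕ → TestFn n ℂ) {f : (Fin n → ℝ) → ℂ} {g : LTwo n}
    (hfg : ⇑g =ᵐ[volume] f) :
    R.Approximates φ f ↔ Tendsto (fun k => testToLTwo n (φ k)) atTop (𝓝 g) ∧
      ∀ δ > 0, ∃ k₀, ∀ k ≥ k₀, ∀ l ≥ k₀, R.energy (φ k - φ l) < δ := by
  rw [Approximates, tendsto_eLpNorm_iff φ hfg]

theorem isValue_iff (f g : LTwo n) : R.IsValue f g ↔ R.MemSobolev f ∧
    ∀ φ, inner ℂ (R.testOp φ) f = inner ℂ (testToLTwo n φ) g := by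
  unfold IsValue
  refine and_congr_right fun _ => forall_congr' fun φ => ?_
  rw [testOp_apply, inner_testToLTwo, inner_testToLTwo, coe_diffOpTest]

end GradedGroup.PositiveRockland

end Embedding

/-! ### Multiplication by a bounded real potential -/

section Potential

variable {n : ℕ} {V : (Fin n → ℝ) → ℝ}

theorem memLp_potential_mul (hV : MemLp V ⊤ volume) (f : LTwo n) :
    MemLp (fun x => (V x : ℂ) * f x) 2 volume := by
  have h : MemLp (fun x => (V x : ℂ)) ⊤ volume := hV.ofReal
  exact MemLp.mul (p := ⊤) (q := 2) (r := 2) (Lp.memLp f) h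

/-- Multiplication by the bounded real potential `V` on `L²`. -/
noncomputable def potentialMul (hV : MemLp V ⊤ volume) : LTwo n →ₗ[ℂ] LTwo n where
  toFun f := (memLp_potential_mul hV f).toLp _
  map_add' f g := by
    rw [← MemLp.toLp_add, MemLp.toLp_eq_toLp_iff]
    filter_upwards [Lp.coeFn_add f g] with x hx
    rw [hx, Pi.add_apply, Pi.add_apply, mul_add]
  map_smul' c f := by
    rw [RingHom.id_apply, ← MemLp.toLp_const_smul, MemLp.toLp_eq_toLp_iff]
    filter_upwards [Lp.coeFn_smul c f] with x hx
    rw [hx, Pi.smul_apply, Pi.smul_apply, smul_eq_mul, smul_eq_mul]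
    ring

theorem coeFn_potentialMul (hV : MemLp V ⊤ volume) (f : LTwo n) :
    ⇑(potentialMul hV f) =ᵐ[volume] fun x => (V x : ℂ) * f x :=
  MemLp.coeFn_toLp (memLp_potential_mul hV f)

theorem norm_potentialMul_le (hV : MemLp V ⊤ volume) (f : LTwo n) :
    ‖potentialMul hV f‖ ≤ (eLpNorm V ⊤ volume).toReal * ‖f‖ := by
  rw [Lp.norm_def, Lp.norm_def, ← ENNReal.toReal_mul]
  refine ENNReal.toReal_mono (ENNReal.mul_ne_top hV.2.ne (Lp.eLpNorm_ne_top f)) ?_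
  rw [eLpNorm_congr_ae (coeFn_potentialMul hV f)]
  have h : (fun x => (V x : ℂ) * f x) = V • (f : (Fin n → ℝ) → ℂ) := by
    funext x; simp
  rw [h]
  exact eLpNorm_smul_le_eLpNorm_top_mul_eLpNorm 2 (Lp.aestronglyMeasurable f) V

theorem inner_potentialMul_symm (hV : MemLp V ⊤ volume) (f g : LTwo n) :
    inner ℂ (potentialMul hV f) g = inner ℂ f (potentialMul hV g) := by
  rw [L2.inner_def, L2.inner_def]
  refine integral_congr_ae ?_
  filter_upwards [coeFn_potentialMul hV f, coeFn_potentialMul hV g] with x hf hg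
  rw [hf, hg, RCLike.inner_apply, RCLike.inner_apply, map_mul, Complex.conj_ofReal]
  ring

theorem im_inner_potentialMul (hV : MemLp V ⊤ volume) (f : LTwo n) :
    (inner ℂ (potentialMul hV f) f).im = 0 := by
  rw [← Complex.conj_eq_iff_im, inner_conj_symm, inner_potentialMul_symm]

theorem neg_le_re_inner_potentialMul (hV : MemLp V ⊤ volume) (f : LTwo n) :
    -((eLpNorm V ⊤ volume).toReal * ‖f‖ ^ 2) ≤ (inner ℂ (potentialMul hV f) f).re := by
  have h1 := (Complex.abs_re_le_norm _).trans (norm_inner_le_norm (𝕜 := ℂ) (potentialMul hV f) f)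
  have h2 := mul_le_mul_of_nonneg_right (norm_potentialMul_le hV f) (norm_nonneg f)
  have h3 := (abs_le.mp (h1.trans h2)).1
  linarith [h3]

end Potential

/-! ### The self-adjoint extension of the Rockland operator -/

namespace GradedGroup.PositiveRockland

variable {n : ℕ} {G : GradedGroup n} (R : G.PositiveRockland) {V : (Fin n → ℝ) → ℝ}

theorem energy_sub (φ ψ : TestFn n ℂ) : R.energy (φ - ψ) =
    R.energy φ + R.energy ψ - 2 * (inner ℂ (R.testOp φ) (testToLTwo n ψ)).re := by
  have h : inner ℂ (R.testOp ψ) (testToLTwo n φ) =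
      conj (inner ℂ (R.testOp φ) (testToLTwo n ψ)) := by
    rw [inner_conj_symm, inner_testOp_symm]
  simp only [energy_eq, map_sub, inner_sub_left, inner_sub_right, Complex.sub_re, h,
    Complex.conj_re]
  ring

theorem energy_sub_le (φ ψ : TestFn n ℂ) :
    R.energy (φ - ψ) ≤ 2 * R.energy φ + 2 * R.energy ψ := by
  have h := R.energy_sub φ (-ψ)
  have h2 := R.energy_sub φ ψ
  have h3 := R.energy_nonneg (φ - -ψ)
  have h4 : R.energy (-ψ) = R.energy ψ := by
    simp only [energy_eq, map_neg, inner_neg_neg]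
  rw [h4, map_neg, inner_neg_right, Complex.neg_re] at h
  linarith

theorem IsValue.sub {f₁ g₁ f₂ g₂ : LTwo n} (h₁ : R.IsValue f₁ g₁) (h₂ : R.IsValue f₂ g₂) :
    R.IsValue (f₁ - f₂) (g₁ - g₂) := by
  rw [isValue_iff] at h₁ h₂ ⊢
  refine ⟨?_, fun φ => by rw [inner_sub_right, inner_sub_right, h₁.2, h₂.2]⟩
  obtain ⟨φ, hφ⟩ := h₁.1
  obtain ⟨ψ, hψ⟩ := h₂.1
  rw [R.approximates_iff _ (EventuallyEq.refl _ _)] at hφ hψ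
  refine ⟨fun k => φ k - ψ k, (R.approximates_iff _ (EventuallyEq.refl _ _)).mpr ⟨?_, ?_⟩⟩
  · simpa only [map_sub] using hφ.1.sub hψ.1
  · intro δ hδ
    obtain ⟨a, ha⟩ := hφ.2 (δ / 4) (by positivity)
    obtain ⟨b, hb⟩ := hψ.2 (δ / 4) (by positivity)
    refine ⟨max a b, fun k hk l hl => ?_⟩
    have h1 := ha k (le_of_max_le_left hk) l (le_of_max_le_left hl)
    have h2 := hb k (le_of_max_le_right hk) l (le_of_max_le_right hl)
    have h3 := R.energy_sub_le (φ k - φ l) (ψ k - ψ l)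
    rw [sub_sub_sub_comm]
    linarith

/-- The self-adjoint extension of `R` is positive. -/
theorem IsValue.re_inner_nonneg {f g : LTwo n} (h : R.IsValue f g) :
    0 ≤ (inner ℂ f g).re := by
  rw [isValue_iff] at h
  obtain ⟨φ, hφ⟩ := h.1
  rw [R.approximates_iff _ (EventuallyEq.refl _ _)] at hφ
  refine le_of_forall_pos_le_add fun δ hδ => ?_
  obtain ⟨k₀, hk₀⟩ := hφ.2 δ hδ
  -- `2 re ⟨R φₖ, φₗ⟩ ≥ -⟨R (φₖ - φₗ), φₖ - φₗ⟩`; then `l → ∞`, then `k → ∞`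
  have h1 : ∀ k ≥ k₀, -δ ≤ (inner ℂ (testToLTwo n (φ k)) g).re := by
    intro k hk
    rw [← h.2]
    have hlim : Tendsto (fun l => (inner ℂ (R.testOp (φ k)) (testToLTwo n (φ l))).re) atTop
        (𝓝 (inner ℂ (R.testOp (φ k)) f).re) :=
      (Complex.continuous_re.tendsto _).comp (tendsto_const_nhds.inner hφ.1)
    refine ge_of_tendsto hlim ?_
    filter_upwards [eventually_ge_atTop k₀] with l hl
    have h2 := R.energy_sub (φ k) (φ l)
    have h3 := hk₀ k hk l hl
    linarith [R.energy_nonneg (φ k), R.energy_nonneg (φ l)]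
  have hlim : Tendsto (fun k => (inner ℂ (testToLTwo n (φ k)) g).re) atTop (𝓝 (inner ℂ f g).re) :=
    (Complex.continuous_re.tendsto _).comp (hφ.1.inner tendsto_const_nhds)
  have h2 : -δ ≤ (inner ℂ f g).re := by
    refine ge_of_tendsto hlim ?_
    filter_upwards [eventually_ge_atTop k₀] with k hk using h1 k hk
  linarith

/-- The inverse `J` of `R + V + λ`, `λ = ‖V‖_∞ + 1`, on the domain of the self-adjoint extension
of `R`. -/
theorem exists_resolvent (hV : MemLp V ⊤ volume) :
    ∃ J : LTwo n →L[ℂ] LTwo n, J.IsPositive ∧ ‖J‖ ≤ 1 ∧ Function.Injective J ∧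
      (∀ z, R.IsValue (J z) (z - potentialMul hV (J z) -
        (((eLpNorm V ⊤ volume).toReal + 1 : ℝ) : ℂ) • J z)) ∧
      ∀ f g, R.IsValue f g → J (g + potentialMul hV f +
        (((eLpNorm V ⊤ volume).toReal + 1 : ℝ) : ℂ) • f) = f := by
  set c : ℝ := (eLpNorm V ⊤ volume).toReal with hc
  set lam : ℂ := ((c + 1 : ℝ) : ℂ) with hlam
  set M := potentialMul hV with hM
  have hre : ∀ f : LTwo n, ‖f‖ ^ 2 ≤ (inner ℂ (M f) f).re + (c + 1) * ‖f‖ ^ 2 := fun f => by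
    have := neg_le_re_inner_potentialMul hV f
    linarith
  let S : TestFn n ℂ →ₗ[ℂ] LTwo n := R.testOp + M ∘ₗ testToLTwo n + lam • testToLTwo n
  have hS : ∀ φ f, inner ℂ (S φ) f = inner ℂ (R.testOp φ) f + inner ℂ (M (testToLTwo n φ)) f +
      lam * inner ℂ (testToLTwo n φ) f := fun φ f => by
    simp only [S, LinearMap.add_apply, LinearMap.comp_apply, LinearMap.smul_apply, inner_add_left,
      inner_smul_left, hlam, Complex.conj_ofReal]
  have hself : ∀ f : LTwo n, lam * inner ℂ f f = (((c + 1) * ‖f‖ ^ 2 : ℝ) : ℂ) := fun f => by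
    rw [inner_self_eq_norm_sq_to_K, hlam]; push_cast; rfl
  have hSre : ∀ φ, (inner ℂ (S φ) (testToLTwo n φ)).re = R.energy φ +
      ((inner ℂ (M (testToLTwo n φ)) (testToLTwo n φ)).re + (c + 1) * ‖testToLTwo n φ‖ ^ 2) :=
    fun φ => by
      rw [hS, hself, Complex.add_re, Complex.add_re, Complex.ofReal_re, energy_eq, add_assoc]
  obtain ⟨J, h1, h2, h3, h4⟩ := exists_friedrichs_resolvent (testToLTwo n) S
    (fun φ => by
      rw [hS, hself, Complex.add_im, Complex.add_im, Complex.ofReal_im, im_inner_testOp,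
        im_inner_potentialMul]; simp)
    (fun φ => by
      rw [hSre]
      linarith [hre (testToLTwo n φ), R.energy_nonneg φ])
    (denseRange_testToLTwo n)
  have hval : ∀ z, R.IsValue (J z) (z - M (J z) - lam • J z) := by
    intro z
    rw [isValue_iff]
    refine ⟨?_, fun φ => ?_⟩
    · obtain ⟨φ, hφ, hq⟩ := (h4 z).1
      refine ⟨φ, (R.approximates_iff _ (EventuallyEq.refl _ _)).mpr ⟨hφ, fun δ hδ => ?_⟩⟩
      obtain ⟨k₀, hk₀⟩ := hq δ hδ
      refine ⟨k₀, fun k hk l hl => lt_of_le_of_lt ?_ (hk₀ k hk l hl)⟩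
      rw [hSre]
      linarith [hre (testToLTwo n (φ k - φ l)), sq_nonneg ‖testToLTwo n (φ k - φ l)‖]
    · have h5 := (h4 z).2 φ
      rw [hS, inner_potentialMul_symm] at h5
      rw [inner_sub_right, inner_sub_right, inner_smul_right, ← h5]
      ring
  refine ⟨J, h1, h2, h3, hval, fun f g hfg => ?_⟩
  -- the difference `d` satisfies `R d = - V d - λ d`, and `R` is positive
  have hd := (hval (g + M f + lam • f)).sub R hfg
  set d := J (g + M f + lam • f) - f with hd'
  have e : g + M f + lam • f - M (J (g + M f + lam • f)) - lam • J (g + M f + lam • f) - g =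
      -(M d + lam • d) := by
    rw [hd', map_sub, smul_sub]; abel
  rw [e] at hd
  have h6 := hd.re_inner_nonneg R
  rw [inner_neg_right, inner_add_right, ← inner_potentialMul_symm, inner_smul_right, hself,
    Complex.neg_re, Complex.add_re, Complex.ofReal_re] at h6
  have h7 : ‖d‖ ^ 2 ≤ 0 := by linarith [hre d]
  have h8 : d = 0 := by
    rw [← norm_eq_zero]; exact pow_eq_zero_iff two_ne_zero |>.mp (le_antisymm h7 (sq_nonneg _))
  exact sub_eq_zero.mp h8

/-! ### The Cauchy problem for a bounded potential -/

theorem isSolution_iff (hV : MemLp V ⊤ volume) {T : ℝ} {u₀ : (Fin n → ℝ) → ℂ} {u : ℝ → LTwo n} :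
    R.IsSolution T V u₀ u ↔ (⇑(u 0) =ᵐ[volume] u₀) ∧
      ∃ u' : ℝ → LTwo n, ContinuousOn u' (Icc 0 T) ∧ ∀ t ∈ Icc 0 T,
        HasDerivWithinAt u (u' t) (Icc 0 T) t ∧
          R.IsValue (u t) (-(u' t + potentialMul hV (u t))) := by
  unfold IsSolution
  refine and_congr_right fun _ => exists_congr fun u' => and_congr_right fun _ =>
    forall_congr' fun t => forall_congr' fun _ => and_congr_right fun _ => ?_
  have key : ∀ w : LTwo n, (∀ᵐ x ∂(volume : Measure (Fin n → ℝ)),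
      u' t x + w x + (V x : ℂ) * u t x = 0) ↔ w = -(u' t + potentialMul hV (u t)) := by
    intro w
    rw [eq_neg_iff_add_eq_zero, Lp.ext_iff]
    refine eventually_congr ?_
    filter_upwards [Lp.coeFn_add w (u' t + potentialMul hV (u t)),
      Lp.coeFn_add (u' t) (potentialMul hV (u t)), coeFn_potentialMul hV (u t),
      Lp.coeFn_zero ℂ 2 (volume : Measure (Fin n → ℝ))] with x h1 h2 h3 h4
    rw [h1, Pi.add_apply, h2, Pi.add_apply, h3, h4, Pi.zero_apply]
    refine Eq.congr ?_ rfl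
    ring
  simp only [key]
  exact ⟨fun ⟨w, h, hw⟩ => hw ▸ h, fun h => ⟨_, h, rfl⟩⟩

/-- The energy estimate for `∂ₜu + R u + V u = 0`. -/
theorem norm_le_exp_mul_norm (hV : MemLp V ⊤ volume) {T : ℝ} {u u' : ℝ → LTwo n}
    (h : ∀ t ∈ Icc 0 T, HasDerivWithinAt u (u' t) (Icc 0 T) t ∧
      R.IsValue (u t) (-(u' t + potentialMul hV (u t)))) {t : ℝ} (ht : t ∈ Icc 0 T) :
    ‖u t‖ ≤ Real.exp ((eLpNorm V ⊤ volume).toReal * t) * ‖u 0‖ := by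
  set c : ℝ := (eLpNorm V ⊤ volume).toReal with hc
  have hder : ∀ t ∈ Icc 0 T, HasDerivWithinAt (fun t => Real.exp (-(2 * c * t)) * ‖u t‖ ^ 2)
      (Real.exp (-(2 * c * t)) * (2 * (inner ℂ (u t) (u' t)).re - 2 * c * ‖u t‖ ^ 2))
      (Icc 0 T) t := by
    intro t ht
    have h1 : HasDerivWithinAt (fun t => ‖u t‖ ^ 2) (2 * (inner ℂ (u t) (u' t)).re)
        (Icc 0 T) t := by
      have h2 := (h t ht).1.inner ℂ (h t ht).1
      have h3 := Complex.reCLM.hasFDerivAt.comp_hasDerivWithinAt t h2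
      refine (h3.congr (fun s _ => ?_) ?_).congr_deriv ?_
      · simp only [Function.comp_apply, Complex.reCLM_apply]
        exact norm_sq_eq_re_inner (𝕜 := ℂ) (u s)
      · simp only [Function.comp_apply, Complex.reCLM_apply]
        exact norm_sq_eq_re_inner (𝕜 := ℂ) (u t)
      · rw [Complex.reCLM_apply, Complex.add_re, ← inner_conj_symm (u' t), Complex.conj_re]
        ring
    have h2 : HasDerivWithinAt (fun t : ℝ => Real.exp (-(2 * c * t)))
        (Real.exp (-(2 * c * t)) * (-(2 * c))) (Icc 0 T) t := by
      have : HasDerivAt (fun t : ℝ => -(2 * c * t)) (-(2 * c)) t := by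
        simpa using ((hasDerivAt_id t).const_mul (2 * c)).fun_neg
      exact this.exp.hasDerivWithinAt
    exact (h2.mul h1).congr_deriv (by ring)
  have hanti : AntitoneOn (fun t => Real.exp (-(2 * c * t)) * ‖u t‖ ^ 2) (Icc 0 T) := by
    refine antitoneOn_of_hasDerivWithinAt_nonpos (convex_Icc 0 T)
      (fun t ht => (hder t ht).continuousWithinAt)
      (fun t ht => (hder t (interior_subset ht)).mono interior_subset) fun t ht => ?_
    refine mul_nonpos_of_nonneg_of_nonpos (Real.exp_pos _).le ?_
    have h1 := ((h t (interior_subset ht)).2).re_inner_nonneg R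
    have h2 := neg_le_re_inner_potentialMul hV (u t)
    rw [inner_neg_right, inner_add_right, ← inner_potentialMul_symm, Complex.neg_re,
      Complex.add_re] at h1
    linarith
  have h0 : (0 : ℝ) ∈ Icc 0 T := ⟨le_rfl, ht.1.trans ht.2⟩
  have h1 := hanti h0 ht ht.1
  simp only [MulZeroClass.mul_zero, neg_zero, Real.exp_zero, one_mul] at h1
  refine abs_le_of_sq_le_sq' ?_ (by positivity) |>.2
  have h2 : Real.exp (c * t) ^ 2 * Real.exp (-(2 * c * t)) = 1 := by
    rw [← Real.exp_nat_mul, ← Real.exp_add, Real.exp_eq_one_iff]; push_cast; ring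
  calc ‖u t‖ ^ 2 = Real.exp (c * t) ^ 2 * (Real.exp (-(2 * c * t)) * ‖u t‖ ^ 2) := by
        rw [← _root_.mul_assoc, h2, one_mul]
    _ ≤ Real.exp (c * t) ^ 2 * ‖u 0‖ ^ 2 := by gcongr
    _ = _ := by ring

theorem IsSolution.norm_le (hV : MemLp V ⊤ volume) {T : ℝ} {u₀ : (Fin n → ℝ) → ℂ} {u : ℝ → LTwo n}
    (hu : R.IsSolution T V u₀ u) {t : ℝ} (ht : t ∈ Icc 0 T) :
    ‖u t‖ ≤ Real.exp ((eLpNorm V ⊤ volume).toReal * t) * ‖u 0‖ := by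
  obtain ⟨-, u', -, h⟩ := (R.isSolution_iff hV).mp hu
  exact R.norm_le_exp_mul_norm hV h ht

theorem IsSolution.eqOn (hV : MemLp V ⊤ volume) {T : ℝ} {u₀ : (Fin n → ℝ) → ℂ} {u v : ℝ → LTwo n}
    (hu : R.IsSolution T V u₀ u) (hv : R.IsSolution T V u₀ v) : EqOn u v (Icc 0 T) := by
  obtain ⟨hu0, u', -, hu⟩ := (R.isSolution_iff hV).mp hu
  obtain ⟨hv0, v', -, hv⟩ := (R.isSolution_iff hV).mp hv
  intro t ht
  have h := R.norm_le_exp_mul_norm hV (u := fun t => u t - v t) (u' := fun t => u' t - v' t)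
    (fun s hs => ⟨(hu s hs).1.sub (hv s hs).1, by
      have := (hu s hs).2.sub R (hv s hs).2
      rw [map_sub]
      convert this using 1
      abel⟩) ht
  have h0 : u 0 = v 0 := Lp.ext (hu0.trans hv0.symm)
  simp only [h0, sub_self, norm_zero, MulZeroClass.mul_zero] at h
  exact sub_eq_zero.mp (norm_le_zero_iff.mp h)

/-- Existence for initial data in the domain of the self-adjoint extension of `R`. -/
theorem exists_isSolution (hV : MemLp V ⊤ volume) (T : ℝ) {u₀ : (Fin n → ℝ) → ℂ} {f g : LTwo n}
    (hf : ⇑f =ᵐ[volume] u₀) (hfg : R.IsValue f g) : ∃ u, R.IsSolution T V u₀ u := by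
  obtain ⟨J, h1, h2, h3, h4, h5⟩ := R.exists_resolvent hV
  set lam : ℝ := (eLpNorm V ⊤ volume).toReal + 1 with hlam
  set z := g + potentialMul hV f + (lam : ℂ) • f with hz
  have hJz : J z = f := h5 f g hfg
  set S := invSemigroup J with hS
  have hcomm : ∀ t w, J (S t w) = S t (J w) := fun t w =>
    (DFunLike.congr_fun (commute_invSemigroup h1 t).eq w).symm
  have hcont := continuous_invSemigroup_apply h1 h2 h3
  let e : ℝ → ℂ := fun t => Complex.exp (lam * t)
  have hecont : Continuous e := by fun_prop
  refine ⟨fun t => e t • S t (J z), (R.isSolution_iff hV).mpr ⟨?_,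
    fun t => ((lam : ℂ) * e t) • S t (J z) - e t • S t z, ?_, fun t ht => ⟨?_, ?_⟩⟩⟩
  · have h0 : e 0 • S 0 (J z) = f := by
      have hS0 : S 0 = 1 := if_pos le_rfl
      simp only [e, hS0, Complex.ofReal_zero, MulZeroClass.mul_zero, Complex.exp_zero, one_smul,
        hJz, one_apply_eq_self]
    rw [h0]; exact hf
  · exact (((continuous_const.mul hecont).smul (hcont _)).sub (hecont.smul (hcont _))).continuousOn
  · have he : HasDerivAt e ((lam : ℂ) * e t) t := by
      have h6 : HasDerivAt (fun t : ℝ => (lam : ℂ) * (t : ℂ)) (lam : ℂ) t := by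
        simpa using (Complex.ofRealCLM.hasDerivAt (x := t)).const_mul (lam : ℂ)
      exact h6.cexp.congr_deriv (mul_comm _ _)
    have hd := (hasDerivWithinAt_invSemigroup h1 h2 h3 z ht.1).mono
      (Icc_subset_Ici_self : Icc 0 T ⊆ Ici 0)
    refine (he.hasDerivWithinAt.smul hd).congr_deriv ?_
    rw [smul_neg, ← sub_eq_neg_add]
  · have h6 := h4 (e t • S t z)
    rw [map_smul, hcomm] at h6
    convert h6 using 1
    beta_reduce
    rw [← smul_smul]
    abel

end GradedGroup.PositiveRockland

/-! ### Differentiation under a compactly supported functional -/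

section Functional

/-- Differentiability of `p ↦ H p` in the topology of uniform convergence of all `y`-derivatives on
a compact set. -/
theorem eventually_norm_iteratedFDeriv_remainder_le {P E F : Type} [NormedAddCommGroup P]
    [NormedSpace ℝ P] [NormedAddCommGroup E] [NormedSpace ℝ E] [NormedAddCommGroup F]
    [NormedSpace ℝ F] {K : Set E} (hK : IsCompact K) (i : ℕ) {H : P → E → F}
    (hH : ContDiff ℝ ∞ (Function.uncurry H)) (p : P) {δ : ℝ} (hδ : 0 < δ) :
    ∀ᶠ v : P in 𝓝 0, ∀ y ∈ K, ‖iteratedFDeriv ℝ i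
      (fun y => H (p + v) y - H p y - fderiv ℝ (fun p => H p y) p v) y‖ ≤ δ * ‖v‖ := by
  induction i generalizing F with
  | zero =>
    have hd : ∀ y, Differentiable ℝ fun p => H p y := fun y =>
      (hH.comp (contDiff_id.prodMk contDiff_const)).differentiable (by simp)
    have hcont : Continuous fun q : P × E => fderiv ℝ (fun p => H p q.2) q.1 := by
      refine (ContDiff.fderiv (m := ∞) (n := 0) (f := fun (q : P × E) (p : P) => H p q.2) ?_
        contDiff_fst (by simp)).continuous
      exact hH.comp (contDiff_snd.prodMk (contDiff_snd.comp contDiff_fst))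
    have h1 : ∀ᶠ q in 𝓝 p, ∀ y ∈ K,
        ‖fderiv ℝ (fun p => H p y) q - fderiv ℝ (fun p => H p y) p‖ ≤ δ := by
      refine hK.eventually_forall_of_forall_eventually fun y _ => ?_
      have h2 : Continuous fun q : P × E => ‖fderiv ℝ (fun p => H p q.2) q.1 -
          fderiv ℝ (fun p => H p q.2) p‖ :=
        (hcont.sub (hcont.comp (continuous_const.prodMk continuous_snd))).norm
      have h3 := (h2.tendsto (p, y)).eventually_lt_const (u := δ) (by simpa using hδ)
      exact h3.mono fun _ h => h.le
    obtain ⟨r, hr, h2⟩ := Metric.eventually_nhds_iff_ball.mp h1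
    filter_upwards [Metric.ball_mem_nhds (0 : P) hr] with v hv y hy
    rw [norm_iteratedFDeriv_zero]
    have hv' : p + v ∈ Metric.ball p r := by simpa using hv
    have h3 := (convex_ball p r).norm_image_sub_le_of_norm_hasFDerivWithin_le'
      (f := fun p => H p y) (φ := fderiv ℝ (fun p => H p y) p)
      (fun q _ => (hd y q).hasFDerivAt.hasFDerivWithinAt) (fun q hq => h2 q hq y hy)
      (Metric.mem_ball_self hr) hv'
    simpa using h3
  | succ i ih =>
    -- the `y`-derivative of the remainder of `H` is the remainder of the `y`-derivative of `H`
    have hH' : ContDiff ℝ ∞ (Function.uncurry fun (p : P) (y : E) => fderiv ℝ (H p) y) :=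
      ContDiff.fderiv (n := ∞) (f := fun q : P × E => H q.1)
        (hH.comp ((contDiff_fst.comp contDiff_fst).prodMk contDiff_snd)) contDiff_snd (by simp)
    filter_upwards [ih hH'] with v hv y hy
    rw [← norm_iteratedFDeriv_fderiv]
    convert hv y hy using 4 with z
    have hHd : Differentiable ℝ (Function.uncurry H) := hH.differentiable (by simp)
    have hDd : Differentiable ℝ (fderiv ℝ (Function.uncurry H)) :=
      (hH.fderiv_right (m := ∞) (by simp)).differentiable (by simp)
    have hleft : ∀ p y, HasFDerivAt (fun p => H p y)
        (fderiv ℝ (Function.uncurry H) (p, y) ∘L ContinuousLinearMap.inl ℝ P E) p := fun p y =>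
      HasFDerivAt.comp (g := Function.uncurry H) (f := fun p => (p, y)) p
        (hHd (p, y)).hasFDerivAt (hasFDerivAt_prodMk_left p y)
    have hright : ∀ p y, HasFDerivAt (H p)
        (fderiv ℝ (Function.uncurry H) (p, y) ∘L ContinuousLinearMap.inr ℝ P E) y := fun p y =>
      HasFDerivAt.comp (g := Function.uncurry H) (f := fun y => (p, y)) y
        (hHd (p, y)).hasFDerivAt (hasFDerivAt_prodMk_right p y)
    have h1 : HasFDerivAt (fun y => fderiv ℝ (fun p => H p y) p v)
        (fderiv ℝ (fun p => fderiv ℝ (H p) z) p v) z := by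
      have e1 : (fun y => fderiv ℝ (fun p => H p y) p v) =
          fun y => fderiv ℝ (Function.uncurry H) (p, y) (v, 0) :=
        funext fun y => by rw [(hleft p y).fderiv]; rfl
      have e2 : (fun p => fderiv ℝ (H p) z) =
          fun p => fderiv ℝ (Function.uncurry H) (p, z) ∘L ContinuousLinearMap.inr ℝ P E :=
        funext fun p => (hright p z).fderiv
      have h3 : HasFDerivAt (fun p => fderiv ℝ (Function.uncurry H) (p, z))
          (fderiv ℝ (fderiv ℝ (Function.uncurry H)) (p, z) ∘L ContinuousLinearMap.inl ℝ P E) p :=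
        HasFDerivAt.comp (g := fderiv ℝ (Function.uncurry H)) (f := fun p => (p, z)) p
          (hDd (p, z)).hasFDerivAt (hasFDerivAt_prodMk_left p z)
      have h4 : HasFDerivAt (fun y => fderiv ℝ (Function.uncurry H) (p, y))
          (fderiv ℝ (fderiv ℝ (Function.uncurry H)) (p, z) ∘L ContinuousLinearMap.inr ℝ P E) z :=
        HasFDerivAt.comp (g := fderiv ℝ (Function.uncurry H)) (f := fun y => (p, y)) z
          (hDd (p, z)).hasFDerivAt (hasFDerivAt_prodMk_right p z)
      have hsymm : IsSymmSndFDerivAt ℝ (Function.uncurry H) (p, z) :=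
        hH.contDiffAt.isSymmSndFDerivAt (by
          rw [minSmoothness_of_isRCLikeNormedField]
          exact WithTop.coe_le_coe.mpr (le_top : (2 : ℕ∞) ≤ ⊤))
      rw [e1, e2]
      refine (h4.clm_apply (hasFDerivAt_const (v, (0 : E)) z)).congr_fderiv ?_
      rw [(h3.clm_comp (hasFDerivAt_const (ContinuousLinearMap.inr ℝ P E) p)).fderiv]
      ext w
      simpa using hsymm (0, w) (v, 0)
    have hz : Differentiable ℝ (H p) := fun y => (hright p y).differentiableAt
    have hz' : Differentiable ℝ (H (p + v)) := fun y => (hright (p + v) y).differentiableAt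
    exact (((hz' z).hasFDerivAt.sub (hz z).hasFDerivAt).sub h1).fderiv

variable {n : ℕ} {F : Type} [NormedAddCommGroup F] [NormedSpace ℝ F]

/-- A linear functional on the smooth functions on `ℝⁿ`, with values in `F`, that is bounded by the
derivatives up to the order `m` on the compact set `K`: a compactly supported distribution. The
values at non-smooth functions are irrelevant. -/
structure IsCompactFunctional (L : ((Fin n → ℝ) → ℝ) → F) (K : Set (Fin n → ℝ)) (m : ℕ)
    (C : ℝ) : Prop where
  isCompact : IsCompact K
  map_add : ∀ f g, ContDiff ℝ ∞ f → ContDiff ℝ ∞ g → L (fun y => f y + g y) = L f + L g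
  map_smul : ∀ (c : ℝ) (f), ContDiff ℝ ∞ f → L (fun y => c * f y) = c • L f
  bound : ∀ f, ContDiff ℝ ∞ f → ∀ M, 0 ≤ M →
    (∀ y ∈ K, ∀ i ≤ m, ‖iteratedFDeriv ℝ i f y‖ ≤ M) → ‖L f‖ ≤ C * M

namespace IsCompactFunctional

variable {L : ((Fin n → ℝ) → ℝ) → F} {K : Set (Fin n → ℝ)} {m : ℕ} {C : ℝ}

theorem map_sub (hL : IsCompactFunctional L K m C) {f g : (Fin n → ℝ) → ℝ} (hf : ContDiff ℝ ∞ f)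
    (hg : ContDiff ℝ ∞ g) : L (fun y => f y - g y) = L f - L g := by
  have h := hL.map_add f (fun y => -1 * g y) hf (contDiff_const.mul hg)
  rw [hL.map_smul _ _ hg] at h
  simpa [sub_eq_add_neg] using h

variable {P : Type} [NormedAddCommGroup P] [NormedSpace ℝ P]
  {Ψ : P → (Fin n → ℝ) → ℝ}

theorem contDiff_partial (hΨ : ContDiff ℝ ∞ (Function.uncurry Ψ)) (v : P) :
    ContDiff ℝ ∞ (Function.uncurry fun p y => fderiv ℝ (fun p => Ψ p y) p v) := by
  have : ContDiff ℝ ∞ fun q : P × (Fin n → ℝ) => fderiv ℝ (fun p => Ψ p q.2) q.1 :=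
    ContDiff.fderiv (n := ∞) (f := fun (q : P × (Fin n → ℝ)) (p : P) => Ψ p q.2)
      (hΨ.comp (contDiff_snd.prodMk (contDiff_snd.comp contDiff_fst))) contDiff_fst (by simp)
  exact this.clm_apply contDiff_const

theorem contDiff_section (hΨ : ContDiff ℝ ∞ (Function.uncurry Ψ)) (p : P) : ContDiff ℝ ∞ (Ψ p) :=
  hΨ.comp (contDiff_const.prodMk contDiff_id)

/-- Differentiation under a compactly supported functional. -/
theorem exists_hasFDerivAt [FiniteDimensional ℝ P] (hL : IsCompactFunctional L K m C)
    (hΨ : ContDiff ℝ ∞ (Function.uncurry Ψ)) (p : P) :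
    ∃ A : P →L[ℝ] F, HasFDerivAt (fun p => L (Ψ p)) A p ∧
      ∀ v, A v = L fun y => fderiv ℝ (fun p => Ψ p y) p v := by
  have hs : ∀ v, ContDiff ℝ ∞ fun y => fderiv ℝ (fun p => Ψ p y) p v := fun v =>
    contDiff_section (contDiff_partial hΨ v) p
  let A : P →ₗ[ℝ] F :=
    { toFun := fun v => L fun y => fderiv ℝ (fun p => Ψ p y) p v
      map_add' := fun v w => by
        rw [← hL.map_add _ _ (hs v) (hs w)]; simp only [_root_.map_add]
      map_smul' := fun c v => by
        rw [RingHom.id_apply, ← hL.map_smul _ _ (hs v)]; simp only [_root_.map_smul, smul_eq_mul] }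
  refine ⟨LinearMap.toContinuousLinearMap A, ?_, fun v => rfl⟩
  rw [hasFDerivAt_iff_isLittleO_nhds_zero, Asymptotics.isLittleO_iff]
  intro c hc
  have hC : 0 < |C| + 1 := by positivity
  have h1 : ∀ᶠ v : P in 𝓝 0, ∀ i ∈ Finset.range (m + 1), ∀ y ∈ K, ‖iteratedFDeriv ℝ i
      (fun y => Ψ (p + v) y - Ψ p y - fderiv ℝ (fun p => Ψ p y) p v) y‖ ≤ c / (|C| + 1) * ‖v‖ := by
    rw [Finset.eventually_all]
    exact fun i _ => eventually_norm_iteratedFDeriv_remainder_le hL.isCompact i hΨ p (by positivity)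
  filter_upwards [h1] with v hv
  have h2 : L (Ψ (p + v)) - L (Ψ p) - LinearMap.toContinuousLinearMap A v =
      L fun y => Ψ (p + v) y - Ψ p y - fderiv ℝ (fun p => Ψ p y) p v := by
    rw [hL.map_sub ((contDiff_section hΨ _).sub (contDiff_section hΨ _)) (hs v),
      hL.map_sub (contDiff_section hΨ _) (contDiff_section hΨ _)]
    rfl
  rw [h2]
  refine (hL.bound _ (((contDiff_section hΨ _).sub (contDiff_section hΨ _)).sub (hs v))
    (c / (|C| + 1) * ‖v‖) (by positivity)
    fun y hy i hi => hv i (Finset.mem_range_succ_iff.mpr hi) y hy).trans ?_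
  calc C * (c / (|C| + 1) * ‖v‖) ≤ (|C| + 1) * (c / (|C| + 1) * ‖v‖) := by
        gcongr; linarith [le_abs_self C]
    _ = c * ‖v‖ := by field_simp

theorem contDiff [FiniteDimensional ℝ P] (hL : IsCompactFunctional L K m C)
    (hΨ : ContDiff ℝ ∞ (Function.uncurry Ψ)) :
    ContDiff ℝ ∞ fun p => L (Ψ p) := by
  rw [contDiff_infty]
  intro k
  induction k generalizing Ψ with
  | zero =>
    rw [Nat.cast_zero, contDiff_zero, continuous_iff_continuousAt]
    intro p
    obtain ⟨A, hA, -⟩ := hL.exists_hasFDerivAt hΨ p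
    exact hA.continuousAt
  | succ k ih =>
    rw [Nat.cast_succ, contDiff_succ_iff_fderiv_apply]
    refine ⟨fun p => ?_, fun h => absurd h (by simp), fun v => ?_⟩
    · obtain ⟨A, hA, -⟩ := hL.exists_hasFDerivAt hΨ p
      exact hA.differentiableAt
    · have h : (fun p => fderiv ℝ (fun p => L (Ψ p)) p v) =
          fun p => L fun y => fderiv ℝ (fun p => Ψ p y) p v := funext fun p => by
        obtain ⟨A, hA, hA'⟩ := hL.exists_hasFDerivAt hΨ p
        rw [hA.fderiv, hA']
      rw [h]
      exact ih (contDiff_partial hΨ v)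

end IsCompactFunctional

end Functional

/-! ### Compactly supported distributions as functionals on smooth functions -/

/-- A compactly supported distribution extends to the smooth functions, `f ↦ U (χ f)` with a
cutoff `χ`, and has finite order. -/
theorem GDistrib.IsCompactlySupported.exists_functional {n : ℕ} {F : Type} [NormedAddCommGroup F]
    [NormedSpace ℝ F] {U : GDistrib n F} (hU : U.IsCompactlySupported) :
    ∃ (L : ((Fin n → ℝ) → ℝ) → F) (K : Set (Fin n → ℝ)) (m : ℕ) (C : ℝ),
      IsCompactFunctional L K m C ∧ ∀ φ : TestFn n ℝ, U φ = L φ := by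
  classical
  obtain ⟨K₀, hK₀, hvan⟩ := hU
  obtain ⟨r, hr, hKr⟩ := hK₀.isBounded.subset_ball_lt 0 (0 : Fin n → ℝ)
  let χ : ContDiffBump (0 : Fin n → ℝ) := ⟨r, r + 1, hr, by linarith⟩
  let K : TopologicalSpace.Compacts (Fin n → ℝ) :=
    ⟨Metric.closedBall 0 (r + 1), isCompact_closedBall _ _⟩
  have hχ : ContDiff ℝ ∞ χ := χ.contDiff
  have hmul : ∀ f : (Fin n → ℝ) → ℝ, Function.support (fun y => χ y * f y) ⊆ K := fun f y hy => by
    have : y ∈ Function.support χ := fun h => hy (by simp only [h, zero_mul])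
    rw [χ.support_eq] at this
    exact Metric.ball_subset_closedBall this
  let cut : ∀ f : (Fin n → ℝ) → ℝ, ContDiff ℝ ∞ f → 𝓓_{K}((Fin n → ℝ), ℝ) := fun f hf =>
    ContDiffMapSupportedIn.of_support_subset (hχ.mul hf) (hmul f)
  have hsub : (K : Set (Fin n → ℝ)) ⊆ (⊤ : TopologicalSpace.Opens (Fin n → ℝ)) :=
    fun _ _ => trivial
  let T : 𝓓_{K}((Fin n → ℝ), ℝ) →L[ℝ] F := U ∘L TestFunction.ofSupportedInCLM ℝ hsub
  let L : ((Fin n → ℝ) → ℝ) → F := fun f => if hf : ContDiff ℝ ∞ f then T (cut f hf) else 0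
  have hLT : ∀ f (hf : ContDiff ℝ ∞ f), L f = T (cut f hf) := fun f hf => dif_pos hf
  obtain ⟨s, B, -, hsB⟩ := Seminorm.bound_of_continuous
    (ContDiffMapSupportedIn.withSeminorms ℝ (Fin n → ℝ) ℝ ⊤ K)
    ((normSeminorm ℝ F).comp T.toLinearMap) (continuous_norm.comp T.continuous)
  obtain ⟨m, hm⟩ : ∃ m, ∀ i ∈ s, i ≤ m := s.exists_le
  -- a bound for the derivatives of the cutoff
  have hD : ∀ i : ℕ, ∃ D : ℝ, ∀ y, ‖iteratedFDeriv ℝ i χ y‖ ≤ D := fun i =>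
    (hχ.continuous_iteratedFDeriv (m := i) (by
      exact_mod_cast le_top)).bounded_above_of_compact_support (χ.hasCompactSupport.iteratedFDeriv i)
  choose D hD using hD
  set D' : ℝ := ∑ i ∈ Finset.range (m + 1), |D i| with hD'
  have hDD : ∀ i ≤ m, ∀ y, ‖iteratedFDeriv ℝ i χ y‖ ≤ D' := fun i hi y =>
    (hD i y).trans ((le_abs_self _).trans (Finset.single_le_sum (f := fun i => |D i|)
      (fun _ _ => abs_nonneg _) (Finset.mem_range_succ_iff.mpr hi)))
  have hD0 : 0 ≤ D' := Finset.sum_nonneg fun _ _ => abs_nonneg _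
  refine ⟨L, K, m, B * (2 ^ m * D'), ⟨K.isCompact, ?_, ?_, ?_⟩, ?_⟩
  · intro f g hf hg
    rw [hLT _ hf, hLT _ hg, hLT _ (hf.add hg), ← _root_.map_add]
    congr 1
    ext y
    exact mul_add _ _ _
  · intro c f hf
    rw [hLT _ hf, hLT _ (contDiff_const.mul hf), ← _root_.map_smul]
    congr 1
    ext y
    exact mul_left_comm _ _ _
  · intro f hf M hM hfM
    rw [hLT _ hf]
    have h1 : ‖T (cut f hf)‖ ≤ B * (s.sup (ContDiffMapSupportedIn.seminorm ℝ (Fin n → ℝ) ℝ ⊤ K))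
        (cut f hf) := hsB (cut f hf)
    refine h1.trans ?_
    rw [mul_assoc]
    gcongr
    have h0 : 0 ≤ 2 ^ m * D' * M := by positivity
    refine Seminorm.finset_sup_apply_le h0 fun i hi => ?_
    rw [ContDiffMapSupportedIn.seminorm_top_le_iff ℝ h0]
    intro y hy
    have him := hm i hi
    calc ‖iteratedFDeriv ℝ i (fun y => χ y * f y) y‖
        ≤ ∑ j ∈ Finset.range (i + 1), (i.choose j : ℝ) * ‖iteratedFDeriv ℝ j χ y‖ *
          ‖iteratedFDeriv ℝ (i - j) f y‖ :=
          norm_iteratedFDeriv_mul_le hχ hf y (by exact_mod_cast le_top)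
      _ ≤ ∑ j ∈ Finset.range (i + 1), (i.choose j : ℝ) * D' * M := by
          refine Finset.sum_le_sum fun j hj => ?_
          have hj' := Finset.mem_range_succ_iff.mp hj
          gcongr
          · exact hDD j (hj'.trans him) y
          · exact hfM y hy _ ((Nat.sub_le _ _).trans him)
      _ = 2 ^ i * D' * M := by
          rw [← Finset.sum_mul, ← Finset.sum_mul]
          congr 2
          exact_mod_cast Nat.sum_range_choose i
      _ ≤ 2 ^ m * D' * M := by gcongr; norm_num
  · intro φ
    rw [hLT _ φ.contDiff]
    change U φ = U (TestFunction.ofSupportedIn hsub (cut φ φ.contDiff))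
    rw [← sub_eq_zero, ← _root_.map_sub]
    refine hvan _ ?_
    -- the difference vanishes on the ball where `χ = 1`
    have h1 : Function.support (φ - TestFunction.ofSupportedIn hsub (cut φ φ.contDiff)) ⊆
        (Metric.ball (0 : Fin n → ℝ) r)ᶜ := by
      intro y hy hyr
      refine hy ?_
      change φ y - χ y * φ y = 0
      rw [χ.one_of_mem_closedBall (Metric.ball_subset_closedBall hyr), one_mul, sub_self]
    have h2 := closure_minimal h1 Metric.isOpen_ball.isClosed_compl
    exact h2.trans (compl_subset_compl.mpr hKr)

/-- Integration against a function that is integrable on a compact set. -/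
theorem isCompactFunctional_setIntegral {n : ℕ} {F : Type} [NormedAddCommGroup F] [NormedSpace ℝ F]
    {K : Set (Fin n → ℝ)} (hK : IsCompact K) {f : (Fin n → ℝ) → F} (hf : IntegrableOn f K) :
    IsCompactFunctional (fun φ => ∫ y in K, φ y • f y) K 0 (∫ y in K, ‖f y‖) where
  isCompact := hK
  map_add φ ψ hφ hψ := by
    simp only [add_smul]
    exact integral_add (hf.continuousOn_smul hφ.continuous.continuousOn hK)
      (hf.continuousOn_smul hψ.continuous.continuousOn hK)
  map_smul c φ _ := by
    simp only [mul_smul]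
    exact integral_smul c _
  bound φ _ M _ hM := by
    rw [mul_comm, ← integral_const_mul]
    refine norm_integral_le_of_norm_le (hf.norm.const_mul M) ?_
    filter_upwards [ae_restrict_mem hK.measurableSet] with y hy
    rw [norm_smul]
    gcongr
    simpa using hM y hy 0 le_rfl

/-! ### Convolution of a compactly supported functional with a test function -/

namespace GradedGroup

variable {n : ℕ} (G : GradedGroup n) {F : Type} [NormedAddCommGroup F] [NormedSpace ℝ F]
  {L : ((Fin n → ℝ) → ℝ) → F} {K : Set (Fin n → ℝ)} {m : ℕ} {C : ℝ}

theorem functional_eq_zero_of_notMem (hL : IsCompactFunctional L K m C) (ψ : TestFn n ℝ)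
    {x : Fin n → ℝ} (hx : x ∉ (fun q : (Fin n → ℝ) × (Fin n → ℝ) => G.mul q.1 q.2) ''
      (K ×ˢ tsupport ψ)) : L (fun y => ψ (G.mul (G.inv y) x)) = 0 := by
  have h := hL.bound (fun y => ψ (G.mul (G.inv y) x)) (ψ.contDiff.comp (G.contDiff_inv_mul x)) 0
    le_rfl fun y hy i _ => ?_
  · rwa [MulZeroClass.mul_zero, norm_le_zero_iff] at h
  · have hy' : G.mul (G.inv y) x ∉ tsupport ψ := fun h =>
      hx ⟨(y, G.mul (G.inv y) x), ⟨hy, h⟩, G.mul_inv_cancel y x⟩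
    have h1 : (fun y => ψ (G.mul (G.inv y) x)) =ᶠ[𝓝 y] 0 := by
      have h2 := (notMem_tsupport_iff_eventuallyEq.mp hy')
      exact ((G.contDiff_inv_mul x).continuous.tendsto y).eventually h2
    rw [h1.iteratedFDeriv ℝ i |>.self_of_nhds]
    simp

/-- The convolution `x ↦ L (ψ (·⁻¹ x))` of a compactly supported functional with a test function is
a test function. -/
noncomputable def convTest (hL : IsCompactFunctional L K m C) (ψ : TestFn n ℝ) : TestFn n F where
  toFun x := L fun y => ψ (G.mul (G.inv y) x)
  contDiff' := hL.contDiff (Ψ := fun x y => ψ (G.mul (G.inv y) x))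
    (ψ.contDiff.comp (G.contDiff_mul.comp ((G.contDiff_inv.comp contDiff_snd).prodMk contDiff_fst)))
  hasCompactSupport' := by
    refine HasCompactSupport.intro ((hL.isCompact.prod ψ.hasCompactSupport).image
      G.contDiff_mul.continuous) fun x hx => G.functional_eq_zero_of_notMem hL ψ hx
  tsupport_subset' := fun _ _ => trivial

theorem convTest_apply (hL : IsCompactFunctional L K m C) (ψ : TestFn n ℝ) (x : Fin n → ℝ) :
    G.convTest hL ψ x = L fun y => ψ (G.mul (G.inv y) x) := rfl

/-- Left-invariant fields commute with left convolutions. -/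
theorem leftDerivTest_convTest (hL : IsCompactFunctional L K m C) (j : Fin n) (ψ : TestFn n ℝ) :
    G.leftDerivTest j (G.convTest hL ψ) = G.convTest hL (G.leftDerivTest j ψ) := by
  ext x
  have hΨ : ContDiff ℝ ∞ (Function.uncurry fun (t : ℝ) (y : Fin n → ℝ) =>
      ψ (G.mul (G.inv y) (G.mul x (Pi.single j t)))) := by
    refine ψ.contDiff.comp (G.contDiff_mul.comp ((G.contDiff_inv.comp contDiff_snd).prodMk
      (G.contDiff_mul.comp (contDiff_const.prodMk ?_))))
    exact (ContinuousLinearMap.single ℝ (fun _ : Fin n => ℝ) j).contDiff.comp contDiff_fst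
  obtain ⟨A, hA, hA'⟩ := hL.exists_hasFDerivAt hΨ 0
  refine hA.hasDerivAt.deriv.trans ?_
  rw [hA', convTest_apply]
  congr 1
  funext y
  rw [fderiv_apply_one_eq_deriv, coe_leftDerivTest]
  unfold leftDeriv
  simp only [G.mul_assoc]

theorem monomialTest_convTest (hL : IsCompactFunctional L K m C) (α : Fin n → ℕ) (ψ : TestFn n ℝ) :
    G.monomialTest α (G.convTest hL ψ) = G.convTest hL (G.monomialTest α ψ) := by
  have hit : ∀ (j : Fin n) (k : ℕ) (ψ : TestFn n ℝ),
      (G.leftDerivTest j)^[k] (G.convTest hL ψ) = G.convTest hL ((G.leftDerivTest j)^[k] ψ) := by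
    intro j k ψ
    induction k with
    | zero => rfl
    | succ k ih => rw [Function.iterate_succ_apply', ih, leftDerivTest_convTest,
        Function.iterate_succ_apply']
  unfold monomialTest
  induction List.finRange n with
  | nil => rfl
  | cons j l ih => rw [List.foldr_cons, ih, hit, List.foldr_cons]

end GradedGroup

/-! ### Polynomial bounds in the scale of the mollifier -/

/-- `A h ≤ C h⁻ᴺ` for `0 < h ≤ h₀`, with a constant that may depend on `h₀`. -/
def IsPolyBounded (A : ℝ → ℝ≥0∞) (N : ℕ) : Prop :=
  ∀ h₀ : ℝ, ∃ C : ℝ, 0 ≤ C ∧ ∀ h ∈ Ioc 0 h₀, A h ≤ ENNReal.ofReal (C * (h ^ N)⁻¹)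

theorem IsPolyBounded.mono {A : ℝ → ℝ≥0∞} {N N' : ℕ} (hA : IsPolyBounded A N) (hN : N ≤ N') :
    IsPolyBounded A N' := by
  intro h₀
  obtain ⟨C, hC, h⟩ := hA h₀
  refine ⟨C * |h₀| ^ (N' - N), by positivity, fun t ht => (h t ht).trans ?_⟩
  have ht0 : 0 < t := ht.1
  have h1 : t ^ (N' - N) ≤ |h₀| ^ (N' - N) := by
    gcongr; exact ht.2.trans (le_abs_self _)
  refine ENNReal.ofReal_le_ofReal ?_
  have h2 : (t ^ N)⁻¹ = t ^ (N' - N) * (t ^ N')⁻¹ := by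
    rw [← Nat.sub_add_cancel hN, pow_add, Nat.add_sub_cancel]
    field_simp
  rw [h2, mul_assoc]
  gcongr

theorem isPolyBounded_of_le {A : ℝ → ℝ≥0∞} {c : ℝ≥0∞} (hc : c ≠ ⊤) (h : ∀ t, 0 < t → A t ≤ c) :
    IsPolyBounded A 0 := fun _ =>
  ⟨c.toReal, ENNReal.toReal_nonneg, fun t ht => by
    simpa [ENNReal.ofReal_toReal hc] using h t ht.1⟩

theorem IsPolyBounded.ne_top {A : ℝ → ℝ≥0∞} {N : ℕ} (hA : IsPolyBounded A N) {t : ℝ} (ht : 0 < t) :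
    A t ≠ ⊤ := by
  obtain ⟨C, -, h⟩ := hA t
  exact ne_top_of_le_ne_top ENNReal.ofReal_ne_top (h t ⟨ht, le_rfl⟩)

theorem IsPolyBounded.of_le {A B : ℝ → ℝ≥0∞} {N : ℕ} (hB : IsPolyBounded B N)
    (h : ∀ t, 0 < t → A t ≤ B t) : IsPolyBounded A N := fun h₀ => by
  obtain ⟨C, hC, hC'⟩ := hB h₀
  exact ⟨C, hC, fun t ht => (h t ht.1).trans (hC' t ht)⟩

theorem IsPolyBounded.add {A B : ℝ → ℝ≥0∞} {N : ℕ} (hA : IsPolyBounded A N)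
    (hB : IsPolyBounded B N) : IsPolyBounded (fun t => A t + B t) N := fun h₀ => by
  obtain ⟨C, hC, hC'⟩ := hA h₀
  obtain ⟨D, hD, hD'⟩ := hB h₀
  refine ⟨C + D, by positivity, fun t ht => (add_le_add (hC' t ht) (hD' t ht)).trans ?_⟩
  have := ht.1
  rw [← ENNReal.ofReal_add (by positivity) (by positivity), ← add_mul]

theorem IsPolyBounded.const_mul {A : ℝ → ℝ≥0∞} {N : ℕ} (hA : IsPolyBounded A N) {c : ℝ≥0∞}
    (hc : c ≠ ⊤) : IsPolyBounded (fun t => c * A t) N := fun h₀ => by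
  obtain ⟨C, hC, hC'⟩ := hA h₀
  refine ⟨c.toReal * C, by positivity, fun t ht => (mul_le_mul_right (hC' t ht) c).trans ?_⟩
  rw [mul_assoc, ENNReal.ofReal_mul ENNReal.toReal_nonneg, ENNReal.ofReal_toReal hc]

theorem IsPolyBounded.sum {ι : Type*} (s : Finset ι) {A : ι → ℝ → ℝ≥0∞} {N : ℕ}
    (hA : ∀ i ∈ s, IsPolyBounded (A i) N) : IsPolyBounded (fun t => ∑ i ∈ s, A i t) N := by
  classical
  induction s using Finset.induction_on with
  | empty => exact fun _ => ⟨0, le_rfl, fun t _ => by simp⟩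
  | insert i s hi ih =>
    simp only [Finset.sum_insert hi]
    exact (hA i (Finset.mem_insert_self i s)).add
      (ih fun j hj => hA j (Finset.mem_insert_of_mem hj))

theorem IsPolyBounded.pow_mul {A : ℝ → ℝ≥0∞} {N : ℕ} (hA : IsPolyBounded A N) (k : ℕ) :
    IsPolyBounded (fun t => ENNReal.ofReal (t⁻¹ ^ k) * A t) (N + k) := fun h₀ => by
  obtain ⟨C, hC, hC'⟩ := hA h₀
  refine ⟨C, hC, fun t ht => (mul_le_mul_right (hC' t ht) _).trans ?_⟩
  have := ht.1
  rw [← ENNReal.ofReal_mul (by positivity)]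
  refine ENNReal.ofReal_le_ofReal (le_of_eq ?_)
  rw [pow_add, mul_inv, inv_pow]
  ring

/-! ### The logarithmic scale -/

theorem logScale_pos {n₀ : ℕ} (hn : 1 ≤ n₀) {ε : ℝ} (hε : ε ∈ Ioo (0 : ℝ) 1) :
    0 < logScale n₀ ε := by
  refine Real.rpow_pos_of_pos ?_ _
  rw [Real.log_rpow hε.1]
  have := Real.log_neg hε.1 hε.2
  have : (0 : ℝ) < n₀ := by exact_mod_cast hn
  nlinarith

theorem inv_logScale_pow {n₀ : ℕ} (hn : 1 ≤ n₀) {ε : ℝ} (hε : ε ∈ Ioo (0 : ℝ) 1) :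
    (logScale n₀ ε ^ n₀)⁻¹ = n₀ * Real.log ε⁻¹ := by
  have h0 : (0 : ℝ) < n₀ := by exact_mod_cast hn
  have h1 : Real.log (ε ^ (-(n₀ : ℝ))) = n₀ * Real.log ε⁻¹ := by
    rw [Real.log_rpow hε.1, Real.log_inv]; ring
  have h2 : 0 ≤ n₀ * Real.log ε⁻¹ :=
    mul_nonneg h0.le (Real.log_nonneg ((one_le_inv₀ hε.1).mpr hε.2.le))
  rw [logScale, h1, ← Real.rpow_natCast, ← Real.rpow_mul h2, ← Real.rpow_neg h2]
  have : -(-(1 / (n₀ : ℝ)) * n₀) = 1 := by field_simp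
  rw [this, Real.rpow_one]

theorem logScale_le {n₀ : ℕ} (hn : 1 ≤ n₀) {ε₀ : ℝ} (hε₀ : ε₀ ∈ Ioo (0 : ℝ) 1) {ε : ℝ}
    (hε : ε ∈ Ioc 0 ε₀) : logScale n₀ ε ≤ logScale n₀ ε₀ := by
  have hε1 : ε ∈ Ioo (0 : ℝ) 1 := ⟨hε.1, hε.2.trans_lt hε₀.2⟩
  have h1 := logScale_pos hn hε₀
  refine le_of_pow_le_pow_left₀ (by omega : n₀ ≠ 0) h1.le ?_
  rw [← inv_le_inv₀ (pow_pos h1 _) (pow_pos (logScale_pos hn hε1) _), inv_logScale_pow hn hε1,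
    inv_logScale_pow hn hε₀]
  gcongr
  exact inv_pos.mpr hε₀.1
  exact hε.1
  exact hε.2

theorem inv_logScale_le {n₀ : ℕ} (hn : 1 ≤ n₀) {ε : ℝ} (hε : ε ∈ Ioo (0 : ℝ) 1) :
    (logScale n₀ ε)⁻¹ ≤ (n₀ + 1) * ε⁻¹ := by
  have h1 : 1 ≤ ε⁻¹ := (one_le_inv₀ hε.1).mpr hε.2.le
  have h0 : (1 : ℝ) ≤ n₀ := by exact_mod_cast hn
  have h2 : 1 ≤ (n₀ + 1) * ε⁻¹ := by nlinarith
  refine le_of_pow_le_pow_left₀ (by omega : n₀ ≠ 0) (by positivity) ?_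
  rw [inv_pow, inv_logScale_pow hn hε]
  calc (n₀ : ℝ) * Real.log ε⁻¹ ≤ (n₀ + 1) * ε⁻¹ := by
        have := Real.log_le_sub_one_of_pos (inv_pos.mpr hε.1)
        have := Real.log_nonneg h1
        nlinarith
    _ ≤ _ := le_self_pow₀ h2 (by omega)

theorem IsPolyBounded.isModerateOfOrder {A : ℝ → ℝ≥0∞} {N : ℕ} (hA : IsPolyBounded A N) {n₀ : ℕ}
    (hn : 1 ≤ n₀) : IsModerateOfOrder (logScale n₀) (fun ε => A (logScale n₀ ε)) N := by
  intro ε₀ hε₀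
  obtain ⟨C, -, h⟩ := hA (logScale n₀ ε₀)
  exact ⟨C, fun ε hε => h _ ⟨logScale_pos hn ⟨hε.1, hε.2.trans_lt hε₀.2⟩, logScale_le hn hε₀ hε⟩⟩

/-! ### Bounds for the mollification of a compactly supported distribution -/

/-- Bounds for the `y`-derivatives that are uniform in a parameter in a compact set. -/
theorem exists_norm_iteratedFDeriv_le {P E F : Type} [NormedAddCommGroup P]
    [NormedSpace ℝ P] [NormedAddCommGroup E] [NormedSpace ℝ E] [NormedAddCommGroup F]
    [NormedSpace ℝ F] {X : Set P} {K : Set E} (hX : IsCompact X) (hK : IsCompact K) (i : ℕ)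
    {H : P → E → F} (hH : ContDiff ℝ ∞ (Function.uncurry H)) :
    ∃ B, ∀ x ∈ X, ∀ y ∈ K, ‖iteratedFDeriv ℝ i (H x) y‖ ≤ B := by
  induction i generalizing F with
  | zero =>
    obtain ⟨B, hB⟩ := (hX.prod hK).exists_bound_of_continuousOn hH.continuous.continuousOn
    exact ⟨B, fun x hx y hy => by rw [norm_iteratedFDeriv_zero]; exact hB (x, y) ⟨hx, hy⟩⟩
  | succ i ih =>
    have hH' : ContDiff ℝ ∞ (Function.uncurry fun (p : P) (y : E) => fderiv ℝ (H p) y) :=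
      ContDiff.fderiv (n := ∞) (f := fun q : P × E => H q.1)
        (hH.comp ((contDiff_fst.comp contDiff_fst).prodMk contDiff_snd)) contDiff_snd (by simp)
    obtain ⟨B, hB⟩ := ih hH'
    exact ⟨B, fun x hx y hy => by rw [← norm_iteratedFDeriv_fderiv]; exact hB x hx y hy⟩

namespace GradedGroup

variable {n : ℕ} (G : GradedGroup n) {F : Type} [NormedAddCommGroup F] [NormedSpace ℝ F]
  {L : ((Fin n → ℝ) → ℝ) → F} {K : Set (Fin n → ℝ)} {m : ℕ} {C : ℝ}

theorem weight_le_homDim (j : Fin n) : G.weight j ≤ G.homDim :=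
  Finset.single_le_sum (f := G.weight) (fun _ _ => Nat.zero_le _) (Finset.mem_univ j)

theorem norm_dilationCLM_le {s : ℝ} (hs : 0 ≤ s) : ‖G.dilationCLM s‖ ≤ (1 + s) ^ G.homDim := by
  refine ContinuousLinearMap.opNorm_le_bound _ (by positivity) fun x => ?_
  rw [pi_norm_le_iff_of_nonneg (by positivity)]
  intro j
  rw [dilationCLM_apply, dilation, norm_mul, norm_pow, Real.norm_of_nonneg hs]
  gcongr
  · calc s ^ G.weight j ≤ (1 + s) ^ G.weight j := by gcongr; linarith
      _ ≤ (1 + s) ^ G.homDim := pow_le_pow_right₀ (by linarith) (G.weight_le_homDim j)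
  · exact norm_le_pi_norm x j

/-- The supports of the mollifiers `ψ_h`, `0 < h ≤ h₀`, lie in a common compact set. -/
theorem exists_isCompact_tsupport_rescale (ψ : TestFn n ℝ) (h₀ : ℝ) :
    ∃ Z : Set (Fin n → ℝ), IsCompact Z ∧ ∀ h ∈ Ioc 0 h₀, tsupport (G.rescale ψ h) ⊆ Z := by
  have hcont : Continuous fun q : ℝ × (Fin n → ℝ) => G.dilation q.1 q.2 := by
    unfold dilation; fun_prop
  have hZ := ((isCompact_Icc (a := 0) (b := h₀)).prod ψ.hasCompactSupport).image hcont
  refine ⟨_, hZ, fun h hh => closure_minimal (fun z hz => ?_) hZ.isClosed⟩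
  have hz' : G.dilation h⁻¹ z ∈ tsupport ψ := by
    refine subset_tsupport _ fun h0 => hz ?_
    rw [G.coe_rescale ψ hh.1, h0, MulZeroClass.mul_zero]
  refine ⟨(h, G.dilation h⁻¹ z), ⟨⟨hh.1.le, hh.2⟩, hz'⟩, ?_⟩
  exact (G.dilationHomeo h hh.1).right_inv z

/-- The mollification `L * ψ_h` of a compactly supported functional is supported in a fixed compact
set and grows at most polynomially in `1 / h`. -/
theorem exists_functional_rescale_le (hL : IsCompactFunctional L K m C) (ψ : TestFn n ℝ) (h₀ : ℝ) :
    ∃ (X : Set (Fin n → ℝ)) (B : ℝ), IsCompact X ∧ 0 ≤ B ∧ ∀ h ∈ Ioc 0 h₀, ∀ x,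
      (x ∉ X → L (fun y => G.rescale ψ h (G.mul (G.inv y) x)) = 0) ∧
        ‖L (fun y => G.rescale ψ h (G.mul (G.inv y) x))‖ ≤
          B * (h ^ (G.homDim + G.homDim * m))⁻¹ := by
  obtain ⟨Z, hZ, hZs⟩ := G.exists_isCompact_tsupport_rescale ψ h₀
  set X := (fun q : (Fin n → ℝ) × (Fin n → ℝ) => G.mul q.1 q.2) '' (K ×ˢ Z) with hXdef
  have hX : IsCompact X := (hL.isCompact.prod hZ).image G.contDiff_mul.continuous
  have hzero : ∀ h ∈ Ioc 0 h₀, ∀ x, x ∉ X →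
      L (fun y => G.rescale ψ h (G.mul (G.inv y) x)) = 0 := fun h hh x hx =>
    G.functional_eq_zero_of_notMem hL _ fun hx' =>
      hx (image_mono (prod_mono_right (hZs h hh)) hx')
  -- bounds for the derivatives of `ψ` and of `y ↦ y⁻¹ x`
  have hψ : ∀ i : ℕ, ∃ D : ℝ, ∀ y, ‖iteratedFDeriv ℝ i ψ y‖ ≤ D := fun i =>
    (ψ.contDiff.continuous_iteratedFDeriv (m := i)
      (by exact_mod_cast le_top)).bounded_above_of_compact_support
        (ψ.hasCompactSupport.iteratedFDeriv i)
  choose D hD using hψ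
  have hΦ : ContDiff ℝ ∞ (Function.uncurry fun x y => G.mul (G.inv y) x) :=
    G.contDiff_mul.comp ((G.contDiff_inv.comp contDiff_snd).prodMk contDiff_fst)
  choose A hA using fun i : ℕ => exists_norm_iteratedFDeriv_le hX hL.isCompact i hΦ
  set D' : ℝ := ∑ i ∈ Finset.range (m + 1), |D i| with hD'
  set A' : ℝ := 1 + ∑ i ∈ Finset.range (m + 1), |A i| with hA'
  have hDD : ∀ i ≤ m, ∀ y, ‖iteratedFDeriv ℝ i ψ y‖ ≤ D' := fun i hi y =>
    (hD i y).trans ((le_abs_self _).trans (Finset.single_le_sum (f := fun i => |D i|)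
      (fun _ _ => abs_nonneg _) (Finset.mem_range_succ_iff.mpr hi)))
  have hAA : ∀ i ≤ m, ∀ x ∈ X, ∀ y ∈ K,
      ‖iteratedFDeriv ℝ i (fun y => G.mul (G.inv y) x) y‖ ≤ A' := fun i hi x hx y hy => by
    have := (le_abs_self (A i)).trans (Finset.single_le_sum (f := fun i => |A i|)
      (fun _ _ => abs_nonneg _) (Finset.mem_range_succ_iff.mpr hi))
    linarith [hA i x hx y hy]
  have hD0 : 0 ≤ D' := Finset.sum_nonneg fun _ _ => abs_nonneg _
  have hA1 : 1 ≤ A' := by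
    have : 0 ≤ ∑ i ∈ Finset.range (m + 1), |A i| := Finset.sum_nonneg fun _ _ => abs_nonneg _
    linarith
  set N := G.homDim + G.homDim * m with hN
  refine ⟨X, |C| * ((m.factorial : ℝ) * D' * A' ^ m * (|h₀| + 1) ^ N), hX, by positivity,
    fun h hh x => ⟨hzero h hh x, ?_⟩⟩
  have hh0 : 0 < h := hh.1
  by_cases hx : x ∈ X
  swap
  · rw [hzero h hh x hx, norm_zero]; positivity
  set s := h⁻¹ with hs
  have hs0 : 0 < s := inv_pos.mpr hh0
  set σ := (1 + s) ^ G.homDim with hσ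
  have hσ1 : 1 ≤ σ := one_le_pow₀ (by linarith)
  have hbound : ∀ y ∈ K, ∀ i ≤ m, ‖iteratedFDeriv ℝ i
      (fun y => G.rescale ψ h (G.mul (G.inv y) x)) y‖ ≤
        s ^ G.homDim * ((m.factorial : ℝ) * D' * (σ * A') ^ m) := by
    intro y hy i hi
    have hsm : ContDiff ℝ ∞ fun y => G.mul (G.inv y) x := G.contDiff_inv_mul x
    have hf : ContDiff ℝ ∞ fun y => G.dilationCLM s (G.mul (G.inv y) x) :=
      (G.dilationCLM s).contDiff.comp hsm
    have e : (fun y => G.rescale ψ h (G.mul (G.inv y) x)) =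
        s ^ G.homDim • (ψ ∘ fun y => G.dilationCLM s (G.mul (G.inv y) x)) := by
      funext y
      rw [G.coe_rescale ψ hh0, ← inv_pow]; rfl
    have hc : ContDiffAt ℝ i (ψ ∘ fun y => G.dilationCLM s (G.mul (G.inv y) x)) y :=
      (ψ.contDiff.comp hf).contDiffAt.of_le (by exact_mod_cast le_top)
    rw [e, iteratedFDeriv_const_smul_apply hc, norm_smul,
      Real.norm_of_nonneg (by positivity)]
    gcongr
    have h1 : ∀ k, 1 ≤ k → k ≤ i → ‖iteratedFDeriv ℝ k
        (fun y => G.dilationCLM s (G.mul (G.inv y) x)) y‖ ≤ (σ * A') ^ k := by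
      intro k hk hki
      have h2 := (G.dilationCLM s).norm_iteratedFDeriv_comp_left (x := y) (n := k) hsm.contDiffAt
        (by exact_mod_cast le_top)
      refine h2.trans ?_
      refine (mul_le_mul (G.norm_dilationCLM_le hs0.le) (hAA k (hki.trans hi) x hx y hy)
        (norm_nonneg _) (by positivity)).trans ?_
      exact le_self_pow₀ (one_le_mul_of_one_le_of_one_le hσ1 hA1) (by omega)
    refine (norm_iteratedFDeriv_comp_le ψ.contDiff hf (by exact_mod_cast le_top) y
      (fun k hk => hDD k (hk.trans hi) _) h1).trans ?_
    have h3 : 1 ≤ σ * A' := one_le_mul_of_one_le_of_one_le hσ1 hA1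
    gcongr
  have h4 := hL.bound _ ((G.rescale ψ h).contDiff.comp (G.contDiff_inv_mul x)) _ (by positivity)
    hbound
  refine h4.trans ?_
  have h5 : s ^ G.homDim * σ ^ m ≤ (|h₀| + 1) ^ N * (h ^ N)⁻¹ := by
    have h6 : 1 + s ≤ (|h₀| + 1) * s := by
      have : h ≤ |h₀| := hh.2.trans (le_abs_self _)
      have : h * s = 1 := mul_inv_cancel₀ hh0.ne'
      nlinarith
    calc s ^ G.homDim * σ ^ m ≤ (1 + s) ^ G.homDim * σ ^ m := by gcongr; linarith
      _ = (1 + s) ^ N := by rw [hσ, ← pow_mul, ← pow_add]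
      _ ≤ ((|h₀| + 1) * s) ^ N := by gcongr
      _ = _ := by rw [mul_pow, hs, inv_pow]
  calc C * (s ^ G.homDim * ((m.factorial : ℝ) * D' * (σ * A') ^ m))
      ≤ |C| * (s ^ G.homDim * ((m.factorial : ℝ) * D' * (σ * A') ^ m)) := by
        gcongr; exact le_abs_self C
    _ = |C| * ((m.factorial : ℝ) * D' * A' ^ m) * (s ^ G.homDim * σ ^ m) := by
        rw [mul_pow]; ring
    _ ≤ |C| * ((m.factorial : ℝ) * D' * A' ^ m) * ((|h₀| + 1) ^ N * (h ^ N)⁻¹) := by gcongr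
    _ = _ := by ring

end GradedGroup

/-! ### Convolution of functions with a test function -/

namespace GradedGroup

variable {n : ℕ} (G : GradedGroup n) {F : Type} [NormedAddCommGroup F] [NormedSpace ℝ F]

theorem lintegral_enorm_ne_top (ψ : TestFn n ℝ) : ∫⁻ y, ‖ψ y‖ₑ ≠ ⊤ :=
  (ψ.continuous.integrable_of_hasCompactSupport ψ.hasCompactSupport).2.ne

/-- The `L¹`-norm of `ψ_h` does not depend on `h`. -/
theorem lintegral_enorm_rescale (ψ : TestFn n ℝ) {h : ℝ} (hh : 0 < h) :
    ∫⁻ y, ‖G.rescale ψ h y‖ₑ = ∫⁻ y, ‖ψ y‖ₑ := by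
  rw [G.lintegral_dilation hh (fun y => ‖G.rescale ψ h y‖ₑ),
    ← lintegral_const_mul' _ _ ENNReal.ofReal_ne_top]
  refine lintegral_congr fun y => ?_
  have e : G.dilation h⁻¹ (G.dilation h y) = y := (G.dilationHomeo h hh).left_inv y
  have hp : (0 : ℝ) < h ^ G.homDim := by positivity
  rw [G.coe_rescale ψ hh, e, enorm_mul, ← _root_.mul_assoc, Real.enorm_of_nonneg (by positivity),
    ← ENNReal.ofReal_mul hp.le, mul_inv_cancel₀ hp.ne', ENNReal.ofReal_one, one_mul]

theorem lintegral_enorm_inv_mul_left (ψ : TestFn n ℝ) (x : Fin n → ℝ) :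
    ∫⁻ y, ‖ψ (G.mul (G.inv y) x)‖ₑ = ∫⁻ y, ‖ψ y‖ₑ :=
  G.lintegral_inv_mul x fun y => ‖ψ y‖ₑ

theorem continuous_inv_mul : Continuous fun q : (Fin n → ℝ) × (Fin n → ℝ) =>
    G.mul (G.inv q.2) q.1 :=
  G.contDiff_mul.continuous.comp
    ((G.contDiff_inv.continuous.comp continuous_snd).prodMk continuous_fst)

theorem aestronglyMeasurable_convolution {f : (Fin n → ℝ) → F}
    (hf : AEStronglyMeasurable f volume) (ψ : TestFn n ℝ) :
    AEStronglyMeasurable (fun x => ∫ y, ψ (G.mul (G.inv y) x) • f y) volume := by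
  refine AEStronglyMeasurable.integral_prod_right' (μ := volume) (ν := volume)
    (f := fun q : (Fin n → ℝ) × (Fin n → ℝ) => ψ (G.mul (G.inv q.2) q.1) • f q.2) ?_
  exact (ψ.continuous.comp G.continuous_inv_mul).aestronglyMeasurable.smul hf.comp_snd

/-- `‖f * ψ‖_∞ ≤ ‖f‖_∞ ‖ψ‖₁`. -/
theorem eLpNorm_top_convolution_le (f : (Fin n → ℝ) → F) (ψ : TestFn n ℝ) :
    eLpNorm (fun x => ∫ y, ψ (G.mul (G.inv y) x) • f y) ⊤ volume ≤
      (∫⁻ y, ‖ψ y‖ₑ) * eLpNorm f ⊤ volume := by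
  rw [eLpNorm_exponent_top]
  refine essSup_le_of_ae_le _ (Eventually.of_forall fun x => ?_)
  refine (enorm_integral_le_lintegral_enorm _).trans ?_
  rw [← G.lintegral_enorm_inv_mul_left ψ x]
  calc ∫⁻ y, ‖ψ (G.mul (G.inv y) x) • f y‖ₑ
      ≤ ∫⁻ y, ‖ψ (G.mul (G.inv y) x)‖ₑ * eLpNorm f ⊤ volume := by
        refine lintegral_mono_ae ?_
        filter_upwards [ae_le_eLpNormEssSup (f := f) (μ := volume)] with y hy
        rw [enorm_smul, eLpNorm_exponent_top]
        gcongr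
    _ = _ := lintegral_mul_const _ (by
        exact (ψ.continuous.comp (G.contDiff_inv_mul x).continuous).measurable.enorm)

/-- Young's inequality `‖f * ψ‖₂ ≤ ‖f‖₂ ‖ψ‖₁`. -/
theorem eLpNorm_two_convolution_le {f : (Fin n → ℝ) → F} (hf : AEStronglyMeasurable f volume)
    (ψ : TestFn n ℝ) :
    eLpNorm (fun x => ∫ y, ψ (G.mul (G.inv y) x) • f y) 2 volume ≤
      (∫⁻ y, ‖ψ y‖ₑ) * eLpNorm f 2 volume := by
  set A := ∫⁻ y, ‖ψ y‖ₑ with hA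
  have hk : Measurable fun q : (Fin n → ℝ) × (Fin n → ℝ) => ‖ψ (G.mul (G.inv q.2) q.1)‖ₑ :=
    (ψ.continuous.comp G.continuous_inv_mul).measurable.enorm
  have hk1 : ∀ x, Measurable fun y => ‖ψ (G.mul (G.inv y) x)‖ₑ := fun x =>
    hk.comp measurable_prodMk_left
  have hk2 : ∀ y, Measurable fun x => ‖ψ (G.mul (G.inv y) x)‖ₑ := fun y =>
    hk.comp measurable_prodMk_right
  -- Cauchy-Schwarz for the measure `|ψ (y⁻¹ x)| dy`, of mass `A`
  have h1 : ∀ x, ‖∫ y, ψ (G.mul (G.inv y) x) • f y‖ₑ ^ (2 : ℝ) ≤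
      A * ∫⁻ y, ‖ψ (G.mul (G.inv y) x)‖ₑ * ‖f y‖ₑ ^ (2 : ℝ) := by
    intro x
    have hx := (hk1 x).aemeasurable (μ := volume)
    have h2 : ‖∫ y, ψ (G.mul (G.inv y) x) • f y‖ₑ ≤
        ∫⁻ y, (‖ψ (G.mul (G.inv y) x)‖ₑ ^ (1 / 2 : ℝ)) *
          (‖ψ (G.mul (G.inv y) x)‖ₑ ^ (1 / 2 : ℝ) * ‖f y‖ₑ) := by
      refine (enorm_integral_le_lintegral_enorm _).trans (le_of_eq (lintegral_congr fun y => ?_))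
      rw [enorm_smul, ← _root_.mul_assoc, ← ENNReal.rpow_add_of_nonneg _ _ (by norm_num)
        (by norm_num)]
      norm_num
    have h3 := ENNReal.lintegral_mul_le_Lp_mul_Lq volume Real.HolderConjugate.two_two
      (hx.pow_const (1 / 2 : ℝ)) ((hx.pow_const (1 / 2 : ℝ)).mul hf.enorm)
    have e1 : ∀ a : ℝ≥0∞, (a ^ (1 / 2 : ℝ)) ^ (2 : ℝ) = a := fun a => by
      rw [← ENNReal.rpow_mul]; norm_num
    calc ‖∫ y, ψ (G.mul (G.inv y) x) • f y‖ₑ ^ (2 : ℝ)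
        ≤ _ := ENNReal.rpow_le_rpow (h2.trans h3) (by norm_num)
      _ = _ := by
        rw [ENNReal.mul_rpow_of_nonneg _ _ (by norm_num), e1, e1]
        simp only [Pi.mul_apply, ENNReal.mul_rpow_of_nonneg _ _ (zero_le_two (α := ℝ)), e1]
        rw [G.lintegral_enorm_inv_mul_left]
  have h2 : ∀ g : (Fin n → ℝ) → F, eLpNorm g 2 volume =
      (∫⁻ x, ‖g x‖ₑ ^ (2 : ℝ)) ^ (1 / 2 : ℝ) := fun g => by
    rw [eLpNorm_eq_lintegral_rpow_enorm_toReal (by norm_num) (by norm_num)]; norm_num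
  rw [h2, h2]
  have hA2 : A = (A ^ (2 : ℝ)) ^ (1 / 2 : ℝ) := by rw [← ENNReal.rpow_mul]; norm_num
  nth_rewrite 1 [hA2]
  rw [← ENNReal.mul_rpow_of_nonneg _ _ (by norm_num)]
  refine ENNReal.rpow_le_rpow ?_ (by norm_num)
  calc ∫⁻ x, ‖∫ y, ψ (G.mul (G.inv y) x) • f y‖ₑ ^ (2 : ℝ)
      ≤ ∫⁻ x, A * ∫⁻ y, ‖ψ (G.mul (G.inv y) x)‖ₑ * ‖f y‖ₑ ^ (2 : ℝ) := lintegral_mono h1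
    _ = A * ∫⁻ x, ∫⁻ y, ‖ψ (G.mul (G.inv y) x)‖ₑ * ‖f y‖ₑ ^ (2 : ℝ) :=
        lintegral_const_mul' _ _ (lintegral_enorm_ne_top ψ)
    _ = A * ∫⁻ y, ∫⁻ x, ‖ψ (G.mul (G.inv y) x)‖ₑ * ‖f y‖ₑ ^ (2 : ℝ) := by
        rw [lintegral_lintegral_swap]
        exact hk.aemeasurable.mul (hf.enorm.comp_snd.pow_const _)
    _ = A * ∫⁻ y, A * ‖f y‖ₑ ^ (2 : ℝ) := by
        congr 1
        refine lintegral_congr fun y => ?_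
        rw [lintegral_mul_const _ (hk2 y), G.lintegral_mul_left (G.inv y) fun x => ‖ψ x‖ₑ]
    _ = A ^ (2 : ℝ) * ∫⁻ y, ‖f y‖ₑ ^ (2 : ℝ) := by
        rw [lintegral_const_mul' _ _ (lintegral_enorm_ne_top ψ), ← _root_.mul_assoc,
          ENNReal.rpow_two, sq]

/-! ### Moderateness of the potential -/

/-- The regularisations of a bounded function or compactly supported distribution are bounded, with
polynomial bounds in the scale of the mollifier. -/
theorem exists_isPolyBounded_potential {V : GDistrib n ℝ}
    (hV : V.IsInLp ⊤ ∨ V.IsCompactlySupported) :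
    ∃ N : ℕ, ∀ ψ : TestFn n ℝ,
      IsPolyBounded (fun h => eLpNorm (G.convolve V (G.rescale ψ h)) ⊤ volume) N ∧
        AEStronglyMeasurable (G.convolve V ψ) volume := by
  rcases hV with ⟨f, hf, hVf⟩ | hV
  · have e : ∀ ψ, G.convolve V ψ = fun x => ∫ y, ψ (G.mul (G.inv y) x) • f y := fun ψ =>
      funext fun x => hVf _
    refine ⟨0, fun ψ => ⟨isPolyBounded_of_le (c := (∫⁻ y, ‖ψ y‖ₑ) * eLpNorm f ⊤ volume)
      (ENNReal.mul_ne_top (lintegral_enorm_ne_top ψ) hf.2.ne) fun h hh => ?_, ?_⟩⟩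
    · rw [e, ← G.lintegral_enorm_rescale ψ hh]
      exact G.eLpNorm_top_convolution_le f _
    · rw [e]; exact G.aestronglyMeasurable_convolution hf.1 ψ
  · obtain ⟨L, K, m, C, hL, hVL⟩ := hV.exists_functional
    have e : ∀ ψ, G.convolve V ψ = G.convTest hL ψ := fun ψ => funext fun x => hVL _
    refine ⟨G.homDim + G.homDim * m, fun ψ => ⟨fun h₀ => ?_, ?_⟩⟩
    · obtain ⟨X, B, -, hB, h⟩ := G.exists_functional_rescale_le hL ψ h₀
      refine ⟨B, hB, fun t ht => ?_⟩
      beta_reduce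
      rw [e, eLpNorm_exponent_top]
      refine eLpNormEssSup_le_of_ae_bound (Eventually.of_forall fun x => ?_)
      exact (h t ht x).2
    · rw [e]; exact (G.convTest hL ψ).continuous.aestronglyMeasurable

/-! ### The regularised datum -/

/-- The convolutions of `U` with test functions are `L²`-limits of the convolutions of a sequence of
compactly supported functionals, and their `L²`-norms are polynomially bounded in the scale of the
mollifier. -/
def IsRegularisable (U : GDistrib n ℂ) (N : ℕ) : Prop :=
  (∀ ψ : TestFn n ℝ, IsPolyBounded (fun h => eLpNorm (G.convolve U (G.rescale ψ h)) 2 volume) N ∧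
    MemLp (G.convolve U ψ) 2 volume) ∧
  ∃ φ : ℕ → TestFn n ℝ → TestFn n ℂ,
    (∀ ψ, Tendsto (fun k => eLpNorm (fun x => φ k ψ x - G.convolve U ψ x) 2 volume) atTop (𝓝 0)) ∧
      ∀ k α ψ, G.monomialTest α (φ k ψ) = φ k (G.monomialTest α ψ)

theorem convolve_smul (U : GDistrib n ℂ) (c : ℝ) (ψ : TestFn n ℝ) :
    G.convolve U (c • ψ) = c • G.convolve U ψ := by
  funext x
  change U _ = c • U _
  rw [← map_smul]
  rfl

theorem exists_isRegularisable {U : GDistrib n ℂ} (hU : U.IsInLp 2 ∨ U.IsCompactlySupported) :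
    ∃ N : ℕ, G.IsRegularisable U N := by
  rcases hU with ⟨f, hf, hUf⟩ | hU
  · have e : ∀ ψ, G.convolve U ψ = fun x => ∫ y, ψ (G.mul (G.inv y) x) • f y := fun ψ =>
      funext fun x => hUf _
    -- approximate `f` by continuous functions with compact support
    have happ : ∀ k : ℕ, ∃ g : (Fin n → ℝ) → ℂ, HasCompactSupport g ∧
        eLpNorm (f - g) 2 volume ≤ (k : ℝ≥0∞)⁻¹ ∧ Continuous g ∧ MemLp g 2 volume := fun k =>
      hf.exists_hasCompactSupport_eLpNorm_sub_le (by norm_num) (by simp)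
    choose g hgc hg hgcont hgL using happ
    have hL : ∀ k, IsCompactFunctional (fun φ => ∫ y in tsupport (g k), φ y • g k y)
        (tsupport (g k)) 0 (∫ y in tsupport (g k), ‖g k y‖) := fun k =>
      isCompactFunctional_setIntegral (hgc k)
        ((hgcont k).integrable_of_hasCompactSupport (hgc k)).integrableOn
    have hconv : ∀ k ψ x, G.convTest (hL k) ψ x = ∫ y, ψ (G.mul (G.inv y) x) • g k y := by
      intro k ψ x
      rw [convTest_apply]
      refine setIntegral_eq_integral_of_forall_compl_eq_zero fun y hy => ?_
      rw [image_eq_zero_of_notMem_tsupport hy, smul_zero]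
    have hint : ∀ (ψ : TestFn n ℝ) (x) {w : (Fin n → ℝ) → ℂ}, MemLp w 2 volume →
        Integrable (fun y => ψ (G.mul (G.inv y) x) • w y) := by
      intro ψ x w hw
      exact memLp_one_iff_integrable.mp (hw.smul (p := 2) (r := 1)
        ((G.reflTranslate ψ x).continuous.memLp_of_hasCompactSupport
          (G.reflTranslate ψ x).hasCompactSupport))
    refine ⟨0, fun ψ => ⟨isPolyBounded_of_le (c := (∫⁻ y, ‖ψ y‖ₑ) * eLpNorm f 2 volume)
      (ENNReal.mul_ne_top (lintegral_enorm_ne_top ψ) hf.2.ne) fun h hh => ?_, ?_⟩,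
      fun k ψ => G.convTest (hL k) ψ, fun ψ => ?_,
      fun k α ψ => G.monomialTest_convTest (hL k) α ψ⟩
    · rw [e, ← G.lintegral_enorm_rescale ψ hh]
      exact G.eLpNorm_two_convolution_le hf.1 _
    · rw [e]
      exact ⟨G.aestronglyMeasurable_convolution hf.1 ψ,
        (G.eLpNorm_two_convolution_le hf.1 ψ).trans_lt
        (ENNReal.mul_lt_top (lintegral_enorm_ne_top ψ).lt_top hf.2)⟩
    · have hle : ∀ k, eLpNorm (fun x => G.convTest (hL k) ψ x - G.convolve U ψ x) 2 volume ≤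
          (∫⁻ y, ‖ψ y‖ₑ) * (k : ℝ≥0∞)⁻¹ := by
        intro k
        have e2 : (fun x => G.convTest (hL k) ψ x - G.convolve U ψ x) =
            fun x => ∫ y, ψ (G.mul (G.inv y) x) • (g k - f) y := by
          funext x
          rw [hconv, e, ← integral_sub (hint ψ x (hgL k)) (hint ψ x hf)]
          simp only [Pi.sub_apply, smul_sub]
        rw [e2]
        refine (G.eLpNorm_two_convolution_le ((hgL k).1.sub hf.1) ψ).trans ?_
        gcongr
        rw [← eLpNorm_neg, neg_sub]
        exact hg k
      refine tendsto_of_tendsto_of_tendsto_of_le_of_le tendsto_const_nhds ?_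
        (fun _ => zero_le) hle
      have := ENNReal.Tendsto.const_mul (a := ∫⁻ y, ‖ψ y‖ₑ) ENNReal.tendsto_inv_nat_nhds_zero
        (Or.inr (lintegral_enorm_ne_top ψ))
      rwa [MulZeroClass.mul_zero] at this
  · obtain ⟨L, K, m, C, hL, hUL⟩ := hU.exists_functional
    have e : ∀ ψ, G.convolve U ψ = G.convTest hL ψ := fun ψ => funext fun x => hUL _
    refine ⟨G.homDim + G.homDim * m, fun ψ => ⟨fun h₀ => ?_, ?_⟩,
      fun _ ψ => G.convTest hL ψ, fun ψ => ?_, fun _ α ψ => G.monomialTest_convTest hL α ψ⟩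
    · obtain ⟨X, B, hX, hB, h⟩ := G.exists_functional_rescale_le hL ψ h₀
      have hvol : volume X ^ (1 / 2 : ℝ) ≠ ⊤ :=
        ENNReal.rpow_ne_top_of_nonneg (by norm_num) hX.measure_lt_top.ne
      refine ⟨(volume X ^ (1 / 2 : ℝ)).toReal * B, by positivity, fun t ht => ?_⟩
      have hind : G.convTest hL (G.rescale ψ t) = X.indicator (G.convTest hL (G.rescale ψ t)) := by
        funext x
        by_cases hx : x ∈ X
        · rw [indicator_of_mem hx]
        · rw [indicator_of_notMem hx]; exact (h t ht x).1 hx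
      beta_reduce
      rw [e, hind, eLpNorm_indicator_eq_eLpNorm_restrict hX.measurableSet]
      refine (eLpNorm_le_of_ae_bound (C := B * (t ^ (G.homDim + G.homDim * m))⁻¹)
        (Eventually.of_forall fun x => (h t ht x).2)).trans (le_of_eq ?_)
      rw [_root_.mul_assoc, ENNReal.ofReal_mul ENNReal.toReal_nonneg, ENNReal.ofReal_toReal hvol,
        Measure.restrict_apply_univ]
      norm_num
    · rw [e]; exact TestFn.memLp _ 2
    · simp [e]

variable {G}

/-- The regularised datum lies in the domain of the self-adjoint extension of `R`. -/
theorem IsRegularisable.exists_isValue {U : GDistrib n ℂ} {N : ℕ} (hU : G.IsRegularisable U N)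
    (R : G.PositiveRockland) (ψ : TestFn n ℝ) :
    ∃ f g : LTwo n, (⇑f =ᵐ[volume] G.convolve U ψ) ∧ R.IsValue f g ∧
      R.sobolevNorm (G.convolve U ψ) ≤ 2 * eLpNorm (G.convolve U ψ) 2 volume +
        ∑ α ∈ R.coeff.support,
          ‖R.coeff α‖ₑ * eLpNorm (G.convolve U (G.monomialTest α ψ)) 2 volume := by
  obtain ⟨hmem, φ, hφ, hmon⟩ := hU
  let F : TestFn n ℝ → LTwo n := fun ψ => (hmem ψ).2.toLp _
  have hF : ∀ ψ, ⇑(F ψ) =ᵐ[volume] G.convolve U ψ := fun ψ => MemLp.coeFn_toLp _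
  have hlim : ∀ ψ, Tendsto (fun k => testToLTwo n (φ k ψ)) atTop (𝓝 (F ψ)) := fun ψ =>
    (PositiveRockland.tendsto_eLpNorm_iff _ (hF ψ)).mp (hφ ψ)
  set f := F ψ with hf
  set g := ∑ α ∈ R.coeff.support, R.coeff α • F (G.monomialTest α ψ) with hg
  have hRlim : Tendsto (fun k => R.testOp (φ k ψ)) atTop (𝓝 g) := by
    have e : ∀ k, R.testOp (φ k ψ) = ∑ α ∈ R.coeff.support,
        R.coeff α • testToLTwo n (φ k (G.monomialTest α ψ)) := fun k => by
      rw [PositiveRockland.testOp_apply, diffOpTest_apply, map_sum]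
      simp only [map_smul, hmon]
    simp only [e]
    exact tendsto_finsetSum _ fun α _ => (hlim _).const_smul _
  have happ : R.Approximates (fun k => φ k ψ) (G.convolve U ψ) := by
    refine (R.approximates_iff _ (hF ψ)).mpr ⟨hlim ψ, fun δ hδ => ?_⟩
    have hs := Real.sqrt_pos.mpr hδ
    obtain ⟨a, ha⟩ := Metric.cauchySeq_iff.mp (hlim ψ).cauchySeq _ hs
    obtain ⟨b, hb⟩ := Metric.cauchySeq_iff.mp hRlim.cauchySeq _ hs
    refine ⟨max a b, fun k hk l hl => ?_⟩
    have h1 := ha k (le_of_max_le_left hk) l (le_of_max_le_left hl)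
    have h2 := hb k (le_of_max_le_right hk) l (le_of_max_le_right hl)
    rw [dist_eq_norm, ← map_sub] at h1 h2
    calc R.energy (φ k ψ - φ l ψ)
        ≤ ‖R.testOp (φ k ψ - φ l ψ)‖ * ‖testToLTwo n (φ k ψ - φ l ψ)‖ := R.energy_le _
      _ < Real.sqrt δ * Real.sqrt δ := mul_lt_mul'' h2 h1 (norm_nonneg _) (norm_nonneg _)
      _ = δ := Real.mul_self_sqrt hδ.le
  refine ⟨f, g, hF ψ, ?_, ?_⟩
  · rw [PositiveRockland.isValue_iff]
    refine ⟨⟨_, (R.approximates_iff _ (EventuallyEq.refl _ _)).mpr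
      ((R.approximates_iff _ (hF ψ)).mp happ)⟩, fun χ => ?_⟩
    have h1 : Tendsto (fun k => inner ℂ (R.testOp χ) (testToLTwo n (φ k ψ))) atTop
        (𝓝 (inner ℂ (R.testOp χ) f)) := tendsto_const_nhds.inner (hlim ψ)
    have h2 : Tendsto (fun k => inner ℂ (testToLTwo n χ) (R.testOp (φ k ψ))) atTop
        (𝓝 (inner ℂ (testToLTwo n χ) g)) := tendsto_const_nhds.inner hRlim
    simp only [R.inner_testOp_symm] at h1
    exact tendsto_nhds_unique h1 h2
  · have hnorm : ∀ ψ, ‖F ψ‖ₑ = eLpNorm (G.convolve U ψ) 2 volume := fun ψ => by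
      rw [Lp.enorm_def]; exact eLpNorm_congr_ae (hF ψ)
    have hgn : ‖g‖ₑ ≤ ∑ α ∈ R.coeff.support,
        ‖R.coeff α‖ₑ * eLpNorm (G.convolve U (G.monomialTest α ψ)) 2 volume := by
      refine (enorm_sum_le _ _).trans (Finset.sum_le_sum fun α _ => ?_)
      rw [enorm_smul, hnorm]
    have hpt : ∀ k, ENNReal.ofReal (Real.sqrt (R.energy (φ k ψ))) + eLpNorm (φ k ψ) 2 volume ≤
        2 * ‖testToLTwo n (φ k ψ)‖ₑ + ‖R.testOp (φ k ψ)‖ₑ := by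
      intro k
      have h1 : eLpNorm (φ k ψ) 2 volume = ‖testToLTwo n (φ k ψ)‖ₑ := by
        rw [Lp.enorm_def]; exact (eLpNorm_congr_ae (coeFn_testToLTwo _)).symm
      have h2 : Real.sqrt (R.energy (φ k ψ)) ≤ ‖testToLTwo n (φ k ψ)‖ + ‖R.testOp (φ k ψ)‖ := by
        rw [Real.sqrt_le_left (by positivity)]
        nlinarith [R.energy_le (φ k ψ), norm_nonneg (testToLTwo n (φ k ψ)),
          norm_nonneg (R.testOp (φ k ψ)),
          mul_nonneg (norm_nonneg (R.testOp (φ k ψ))) (norm_nonneg (testToLTwo n (φ k ψ)))]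
      have h3 := ENNReal.ofReal_le_ofReal h2
      rw [ENNReal.ofReal_add (norm_nonneg _) (norm_nonneg _), ofReal_norm, ofReal_norm] at h3
      rw [h1, two_mul]
      calc _ ≤ ‖testToLTwo n (φ k ψ)‖ₑ + ‖R.testOp (φ k ψ)‖ₑ + ‖testToLTwo n (φ k ψ)‖ₑ := by gcongr
        _ = _ := by ring
    have hinf : R.sobolevNorm (G.convolve U ψ) ≤ limsup (fun k =>
        ENNReal.ofReal (Real.sqrt (R.energy (φ k ψ))) + eLpNorm (φ k ψ) 2 volume) atTop :=
      iInf₂_le (fun k => φ k ψ) happ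
    refine hinf.trans ((limsup_le_limsup (Eventually.of_forall hpt)).trans ?_)
    have ht : Tendsto (fun k => 2 * ‖testToLTwo n (φ k ψ)‖ₑ + ‖R.testOp (φ k ψ)‖ₑ) atTop
        (𝓝 (2 * ‖f‖ₑ + ‖g‖ₑ)) :=
      (ENNReal.Tendsto.const_mul (hlim ψ).enorm (Or.inr (by simp))).add hRlim.enorm
    rw [ht.limsup_eq, hf, hnorm]
    gcongr

/-- The Sobolev norm of the regularised datum is polynomially bounded in the scale of the
mollifier: `X^α` is homogeneous, so that `X^α (U * ψ_h)` is `h` to the power `-ν` times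
`U * (X^α ψ)_h`. -/
theorem IsRegularisable.isPolyBounded_sobolevNorm {U : GDistrib n ℂ} {N : ℕ}
    (hU : G.IsRegularisable U N) (R : G.PositiveRockland) (ψ : TestFn n ℝ) :
    IsPolyBounded (fun h => R.sobolevNorm (G.convolve U (G.rescale ψ h))) (N + R.degree) := by
  have h1 : IsPolyBounded (fun h => 2 * eLpNorm (G.convolve U (G.rescale ψ h)) 2 volume +
      ∑ α ∈ R.coeff.support, ‖R.coeff α‖ₑ * (ENNReal.ofReal (h⁻¹ ^ R.degree) *
        eLpNorm (G.convolve U (G.rescale (G.monomialTest α ψ) h)) 2 volume)) (N + R.degree) :=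
    (((hU.1 ψ).1.mono (Nat.le_add_right _ _)).const_mul (by simp)).add
      (IsPolyBounded.sum _ fun α _ => (((hU.1 _).1.pow_mul R.degree).const_mul enorm_ne_top))
  refine h1.of_le fun h hh => ?_
  obtain ⟨-, -, -, -, hle⟩ := hU.exists_isValue R (G.rescale ψ h)
  refine hle.trans (le_of_eq ?_)
  congr 1
  refine Finset.sum_congr rfl fun α hα => ?_
  rw [G.monomialTest_rescale α ψ hh, R.homogeneous α hα, convolve_smul, eLpNorm_const_smul,
    Real.enorm_of_nonneg (by positivity)]

end GradedGroup

/-! ### Moderateness of the solution -/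

theorem toReal_le_of_le_logScale {n₀ : ℕ} (hn : 1 ≤ n₀) {a : ℝ≥0∞} {C ε : ℝ}
    (hε : ε ∈ Ioo (0 : ℝ) 1) (h : a ≤ ENNReal.ofReal (C * (logScale n₀ ε ^ n₀)⁻¹)) :
    a.toReal ≤ |C| * (n₀ * Real.log ε⁻¹) := by
  have hl : 0 ≤ Real.log ε⁻¹ := Real.log_nonneg ((one_le_inv₀ hε.1).mpr hε.2.le)
  refine ENNReal.toReal_le_of_le_ofReal (by positivity) (h.trans (ENNReal.ofReal_le_ofReal ?_))
  rw [inv_logScale_pow hn hε]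
  gcongr
  exact le_abs_self C

/-- If `a ε = O(log (1 / ε))`, then `exp (T a ε)` is bounded by a power of `1 / ε`. The power is
determined by the constant for `ε ≤ 1 / 2`, since the factor remains bounded for larger `ε`. -/
theorem IsModerateOfOrder.exists_exp_le {n₀ : ℕ} (hn : 1 ≤ n₀) {a : ℝ → ℝ≥0∞}
    (ha : IsModerateOfOrder (logScale n₀) a n₀) {T : ℝ} (hT : 0 ≤ T) :
    ∃ N : ℕ, ∀ ε₀ ∈ Ioo (0 : ℝ) 1, ∃ B : ℝ, 0 ≤ B ∧ ∀ ε ∈ Ioc 0 ε₀,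
      Real.exp ((a ε).toReal * T) ≤ B * (ε ^ N)⁻¹ := by
  obtain ⟨C₁, h₁⟩ := ha (1 / 2) (by norm_num)
  set N := ⌈|C₁| * n₀ * T⌉₊ with hN
  refine ⟨N, fun ε₀ hε₀ => ?_⟩
  obtain ⟨C₂, h₂⟩ := ha ε₀ hε₀
  refine ⟨Real.exp (|C₂| * (n₀ * Real.log 2) * T), (Real.exp_pos _).le, fun ε hε => ?_⟩
  have hε1 : ε ∈ Ioo (0 : ℝ) 1 := ⟨hε.1, hε.2.trans_lt hε₀.2⟩
  have hl : 0 ≤ Real.log ε⁻¹ := Real.log_nonneg ((one_le_inv₀ hε.1).mpr hε1.2.le)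
  have hl2 : 0 ≤ Real.log 2 := Real.log_nonneg (by norm_num)
  have hpow : (ε ^ N)⁻¹ = Real.exp (N * Real.log ε⁻¹) := by
    rw [Real.exp_nat_mul, Real.exp_log (inv_pos.mpr hε.1), inv_pow]
  rw [hpow, ← Real.exp_add]
  refine Real.exp_le_exp.mpr ?_
  rcases le_or_gt ε (1 / 2) with h | h
  · have h3 := toReal_le_of_le_logScale hn hε1 (h₁ ε ⟨hε.1, h⟩)
    have h4 : (a ε).toReal * T ≤ N * Real.log ε⁻¹ :=
      calc (a ε).toReal * T ≤ |C₁| * (n₀ * Real.log ε⁻¹) * T := by gcongr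
        _ = |C₁| * n₀ * T * Real.log ε⁻¹ := by ring
        _ ≤ N * Real.log ε⁻¹ := by gcongr; exact Nat.le_ceil _
    have : 0 ≤ |C₂| * (n₀ * Real.log 2) * T := by positivity
    linarith
  · have h3 := toReal_le_of_le_logScale hn hε1 (h₂ ε hε)
    have h5 : Real.log ε⁻¹ ≤ Real.log 2 :=
      Real.log_le_log (inv_pos.mpr hε.1) (by rw [inv_le_comm₀ hε.1 two_pos]; linarith)
    have h4 : (a ε).toReal * T ≤ |C₂| * (n₀ * Real.log 2) * T := by
      gcongr
      exact h3.trans (by gcongr)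
    have : 0 ≤ N * Real.log ε⁻¹ := by positivity
    linarith

/-- The energy estimate `‖u t‖ ≤ exp (t ‖V‖_∞) ‖u 0‖` yields moderateness in powers of `ε`, when the
potentials are of size `log (1 / ε)`. -/
theorem GradedGroup.PositiveRockland.isModerate_solution {n : ℕ} {G : GradedGroup n}
    (R : G.PositiveRockland) {T : ℝ} (hT : 0 ≤ T) {n₀ : ℕ} (hn : 1 ≤ n₀)
    {V : ℝ → (Fin n → ℝ) → ℝ} (hVm : ∀ ε ∈ Ioo (0 : ℝ) 1, MemLp (V ε) ⊤ volume)
    (hV : IsModerateOfOrder (logScale n₀) (fun ε => eLpNorm (V ε) ⊤ volume) n₀)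
    {u₀ : ℝ → (Fin n → ℝ) → ℂ}
    (hu₀ : IsModerate (logScale n₀) (fun ε => eLpNorm (u₀ ε) 2 volume))
    {u : ℝ → ℝ → LTwo n} (hu : ∀ ε ∈ Ioo (0 : ℝ) 1, R.IsSolution T (V ε) (u₀ ε) (u ε)) :
    IsModerate (fun ε => ε) (fun ε => ⨆ t ∈ Icc 0 T, ‖u ε t‖ₑ) := by
  obtain ⟨N₁, h₁⟩ := hV.exists_exp_le hn hT
  obtain ⟨N₂, h₂⟩ := hu₀
  refine ⟨N₁ + N₂, fun ε₀ hε₀ => ?_⟩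
  obtain ⟨B, hB, hexp⟩ := h₁ ε₀ hε₀
  obtain ⟨C, hC⟩ := h₂ ε₀ hε₀
  refine ⟨B * (|C| * (n₀ + 1) ^ N₂), fun ε hε => iSup₂_le fun t ht => ?_⟩
  have hε1 : ε ∈ Ioo (0 : ℝ) 1 := ⟨hε.1, hε.2.trans_lt hε₀.2⟩
  have hε0 : 0 < ε := hε.1
  have hs := logScale_pos hn hε1
  have h0 : ‖u ε 0‖ ≤ |C| * ((n₀ + 1) * ε⁻¹) ^ N₂ := by
    have e : ‖u ε 0‖ₑ = eLpNorm (u₀ ε) 2 volume := by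
      rw [Lp.enorm_def]; exact eLpNorm_congr_ae (hu ε hε1).1
    rw [← ofReal_norm] at e
    refine (ENNReal.ofReal_le_ofReal_iff (by positivity)).mp ?_
    rw [e]
    refine (hC ε hε).trans (ENNReal.ofReal_le_ofReal ?_)
    rw [← inv_pow]
    gcongr
    · exact le_abs_self C
    · exact inv_logScale_le hn hε1
  rw [← ofReal_norm]
  refine ENNReal.ofReal_le_ofReal ?_
  calc ‖u ε t‖ ≤ Real.exp ((eLpNorm (V ε) ⊤ volume).toReal * t) * ‖u ε 0‖ :=
        (hu ε hε1).norm_le R (hVm ε hε1) ht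
    _ ≤ Real.exp ((eLpNorm (V ε) ⊤ volume).toReal * T) * ‖u ε 0‖ := by gcongr; exact ht.2
    _ ≤ (B * (ε ^ N₁)⁻¹) * (|C| * ((n₀ + 1) * ε⁻¹) ^ N₂) := by
        gcongr
        exact hexp ε hε
    _ = _ := by rw [pow_add, mul_pow, _root_.mul_inv, inv_pow]; ring

theorem mainTheorem2 {n : ℕ} (G : GradedGroup n) (R : G.PositiveRockland) (T : ℝ) (hT : 0 < T)
    (V : GDistrib n ℝ) (hV : V.IsInLp ⊤ ∨ V.IsCompactlySupported)
    (u₀ : GDistrib n ℂ) (hu₀ : u₀.IsInLp 2 ∨ u₀.IsCompactlySupported) :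
    ∃ n₀ : ℕ, 1 ≤ n₀ ∧ ∀ ψ : TestFn n ℝ, IsFriedrichsMollifier ψ →
      IsModerateOfOrder (logScale n₀)
          (fun ε => eLpNorm (G.regularise ψ (logScale n₀) V ε) ⊤ volume) n₀ ∧
        ∃ u : ℝ → ℝ → LTwo n, IsVeryWeakSolution R T V u₀ ψ (logScale n₀) u := by
  obtain ⟨N, hN⟩ := G.exists_isPolyBounded_potential hV
  obtain ⟨N₂, hN₂⟩ := G.exists_isRegularisable hu₀
  -- `n₀` must bound the order of growth of the potential and be positive
  have hn : 1 ≤ N + 1 := Nat.le_add_left 1 N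
  refine ⟨N + 1, hn, fun ψ _ => ?_⟩
  have hVmod : IsModerateOfOrder (logScale (N + 1))
      (fun ε => eLpNorm (G.regularise ψ (logScale (N + 1)) V ε) ⊤ volume) (N + 1) :=
    ((hN ψ).1.mono (Nat.le_succ N)).isModerateOfOrder hn
  have hVm : ∀ ε ∈ Ioo (0 : ℝ) 1, MemLp (G.regularise ψ (logScale (N + 1)) V ε) ⊤ volume :=
    fun ε hε => ⟨(hN _).2, ((hN ψ).1.ne_top (logScale_pos hn hε)).lt_top⟩
  have hex : ∀ ε, ∃ u : ℝ → LTwo n, ε ∈ Ioo (0 : ℝ) 1 →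
      R.IsSolution T (G.regularise ψ (logScale (N + 1)) V ε)
        (G.regularise ψ (logScale (N + 1)) u₀ ε) u := by
    intro ε
    by_cases hε : ε ∈ Ioo (0 : ℝ) 1
    · obtain ⟨f, g, hf, hfg, -⟩ := hN₂.exists_isValue R (G.rescale ψ (logScale (N + 1) ε))
      obtain ⟨u, hu⟩ := R.exists_isSolution (hVm ε hε) T hf hfg
      exact ⟨u, fun _ => hu⟩
    · exact ⟨0, fun h => absurd h hε⟩
  choose u hu using hex
  exact ⟨hVmod, u,
    { potential_moderate := ⟨_, hVmod⟩
      datum_moderate := ⟨_, (hN₂.isPolyBounded_sobolevNorm R ψ).isModerateOfOrder hn⟩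
      solution := hu
      unique := fun ε hε v hv => hv.eqOn R (hVm ε hε) (hu ε hε)
      solution_moderate := R.isModerate_solution hT.le hn hVm hVmod
        ⟨_, (hN₂.1 ψ).1.isModerateOfOrder hn⟩ hu }⟩
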